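/- In Diameter Matrix Completion (DMC) one is given integers $n,\ell\ge 0$, a matrix $\mathbf S\in\{0,1,\square\}^{n\times\ell}$ ($\square$ denotes a missing entry) and $\alpha\le\beta\in\mathbb N$. A completion of $\mathbf S$ is a matrix $\mathbf T\in\{0,1\}^{n\times\ell}$ with $\mathbf T[i,j]=\mathbf S[i,j]$ whenever $\mathbf S[i,j]\ne\square$. With $d$ the Hamming distance, let $\gamma(\mathbf T)=\min_{i\ne i'}d(\mathbf T[i],\mathbf T[i'])$ and $\delta(\mathbf T)=\max_{i\ne i'}d(\mathbf T[i],\mathbf T[i'])$ be the least and the largest distance between two different rows (for $n\le 1$, $\gamma(\mathbf T)=\infty$ and $\delta(\mathbf T)=0$). The question is whether $\mathbf S$ has a completion $\mathbf T$ with $\alpha\le\gamma(\mathbf T)$ and $\delta(\mathbf T)\le\beta$. The machine model is a deterministic random access machine with indirect addressing of memory. Each elementary operation (reading or writing a register or a memory cell, a constant, addition, truncated subtraction, multiplication, a test for zero) costs one step. It operates on words of $O(\log(n+\ell+\alpha+\beta+2))$ bits; exceeding the word size is an error. The input consists of $n,\ell,\alpha,\beta$ in four registers and the entries of $\mathbf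 S$ row by row in memory, one per cell; all other cells are $0$. Theorem. DMC can be decided in $O(n^2\ell)$ time when every row has at most two missing entries and $\alpha=\beta$. That is, there are a program and a constant $C$ such that, on every instance $(\mathbf S,\alpha,\beta)$ with $\alpha=\beta$ in which every row of $\mathbf S$ has at most two missing entries, the program halts after at most $C\,(n^2\ell+1)$ steps, with output $1$ if the answer is yes and output $0$ if the answer is no. -/

import Mathlib

/-! ### The problem: Diameter Matrix Completion -/

namespace DMC

/-- An `n × ℓ` matrix with entries in `{0, 1, □}`; `none` is the missing entry `□`. -/
abbrev PartialMatrix (n ℓ : ℕ) : Type := Matrix (Fin n) (Fin ℓ) (Option Bool)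

/-- `T` is a completion of `S`: every non-missing entry of `S` is kept. -/
def IsCompletion {n ℓ : ℕ} (S : PartialMatrix n ℓ) (T : Matrix (Fin n) (Fin ℓ) Bool) : Prop :=
  ∀ i j, S i j = none ∨ S i j = some (T i j)

/-- The least Hamming distance between two different rows (`⊤` if there are no two rows). -/
noncomputable def minDist {n ℓ : ℕ} (T : Matrix (Fin n) (Fin ℓ) Bool) : ℕ∞ :=
  ⨅ (i : Fin n) (i' : Fin n) (_ : i ≠ i'), (hammingDist (T i) (T i') : ℕ∞)

/-- The largest Hamming distance between two different rows (`0` if there are no two rows). -/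
noncomputable def maxDist {n ℓ : ℕ} (T : Matrix (Fin n) (Fin ℓ) Bool) : ℕ∞ :=
  ⨆ (i : Fin n) (i' : Fin n) (_ : i ≠ i'), (hammingDist (T i) (T i') : ℕ∞)

/-- `(S, α, β)` is a yes-instance of Diameter Matrix Completion. -/
def IsYes {n ℓ : ℕ} (S : PartialMatrix n ℓ) (α β : ℕ) : Prop :=
  ∃ T : Matrix (Fin n) (Fin ℓ) Bool,
    IsCompletion S T ∧ (α : ℕ∞) ≤ minDist T ∧ maxDist T ≤ (β : ℕ∞)

/-- The maximum number of missing entries in a row. -/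
def maxMissing {n ℓ : ℕ} (S : PartialMatrix n ℓ) : ℕ :=
  Finset.univ.sup fun i : Fin n => (Finset.univ.filter fun j : Fin ℓ => S i j = none).card

end DMC

/-! ### The machine: a random access machine with bounded words and a step count -/

namespace RAM

/-- A configuration: finitely many of the registers are named in a program, while the memory is
addressed indirectly. -/
structure State where
  reg : ℕ → ℕ
  mem : ℕ → ℕ

/-- Arithmetic expressions; `mem a` reads the memory cell whose address is the value of `a`. -/
inductive Expr where
  | lit (c : ℕ)
  | reg (x : ℕ)
  | mem (a : Expr)
  | add (a b : Expr)
  | sub (a b : Expr)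
  | mul (a b : Expr)

/-- The value of an expression (`sub` is truncated subtraction). -/
def Expr.eval (s : State) : Expr → ℕ
  | .lit c => c
  | .reg x => s.reg x
  | .mem a => s.mem (a.eval s)
  | .add a b => a.eval s + b.eval s
  | .sub a b => a.eval s - b.eval s
  | .mul a b => a.eval s * b.eval s

/-- The number of elementary operations in an expression. -/
def Expr.cost : Expr → ℕ
  | .lit _ => 1
  | .reg _ => 1
  | .mem a => a.cost + 1
  | .add a b => a.cost + b.cost + 1
  | .sub a b => a.cost + b.cost + 1
  | .mul a b => a.cost + b.cost + 1

/-- All values that arise while the expression is evaluated, memory addresses included, fit into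
a word, that is, are at most `B`. -/
def Expr.Fits (B : ℕ) (s : State) : Expr → Prop
  | .lit c => c ≤ B
  | .reg x => s.reg x ≤ B
  | .mem a => a.Fits B s ∧ s.mem (a.eval s) ≤ B
  | .add a b => a.Fits B s ∧ b.Fits B s ∧ a.eval s + b.eval s ≤ B
  | .sub a b => a.Fits B s ∧ b.Fits B s
  | .mul a b => a.Fits B s ∧ b.Fits B s ∧ a.eval s * b.eval s ≤ B

/-- Programs. Tests ask whether the value of an expression is nonzero. -/
inductive Prog where
  | skip
  | assign (x : ℕ) (e : Expr)
  | store (a e : Expr)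
  | seq (p q : Prog)
  | ite (e : Expr) (p q : Prog)
  | while (e : Expr) (p : Prog)

/-- `Exec B p s t s'`: with words holding the numbers `0, …, B`, the program `p`, started in `s`,
halts in `s'` after exactly `t` elementary steps. A number that exceeds `B` is a fatal error: then
there is no halting execution. -/
inductive Exec (B : ℕ) : Prog → State → ℕ → State → Prop
  | skip (s : State) : Exec B .skip s 1 s
  | assign (s : State) (x : ℕ) (e : Expr) (he : e.Fits B s) :
      Exec B (.assign x e) s (e.cost + 1) { s with reg := Function.update s.reg x (e.eval s) }
  | store (s : State) (a e : Expr) (ha : a.Fits B s) (he : e.Fits B s) :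
      Exec B (.store a e) s (a.cost + e.cost + 1)
        { s with mem := Function.update s.mem (a.eval s) (e.eval s) }
  | seq {p q : Prog} {s s₁ s₂ : State} {t₁ t₂ : ℕ}
      (hp : Exec B p s t₁ s₁) (hq : Exec B q s₁ t₂ s₂) : Exec B (.seq p q) s (t₁ + t₂) s₂
  | ite_true {e : Expr} {p q : Prog} {s s₁ : State} {t : ℕ} (he : e.Fits B s)
      (h : e.eval s ≠ 0) (hp : Exec B p s t s₁) : Exec B (.ite e p q) s (e.cost + 1 + t) s₁
  | ite_false {e : Expr} {p q : Prog} {s s₁ : State} {t : ℕ} (he : e.Fits B s)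
      (h : e.eval s = 0) (hq : Exec B q s t s₁) : Exec B (.ite e p q) s (e.cost + 1 + t) s₁
  | while_true {e : Expr} {p : Prog} {s s₁ s₂ : State} {t₁ t₂ : ℕ} (he : e.Fits B s)
      (h : e.eval s ≠ 0) (hp : Exec B p s t₁ s₁) (hw : Exec B (.while e p) s₁ t₂ s₂) :
      Exec B (.while e p) s (e.cost + 1 + t₁ + t₂) s₂
  | while_false {e : Expr} {p : Prog} {s : State} (he : e.Fits B s) (h : e.eval s = 0) :
      Exec B (.while e p) s (e.cost + 1) s

/-- The machine is deterministic: the running time and the final state are determined. -/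
theorem Exec.unique {B : ℕ} {p : Prog} {s s₁ s₂ : State} {t₁ t₂ : ℕ}
    (h₁ : Exec B p s t₁ s₁) (h₂ : Exec B p s t₂ s₂) : t₁ = t₂ ∧ s₁ = s₂ := by
  induction h₁ generalizing t₂ s₂ with
  | skip => cases h₂; exact ⟨rfl, rfl⟩
  | assign => cases h₂; exact ⟨rfl, rfl⟩
  | store => cases h₂; exact ⟨rfl, rfl⟩
  | seq _ _ ihp ihq =>
    cases h₂ with
    | seq hp hq =>
      obtain ⟨rfl, rfl⟩ := ihp hp
      obtain ⟨rfl, rfl⟩ := ihq hq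
      exact ⟨rfl, rfl⟩
  | ite_true _ h _ ih =>
    cases h₂ with
    | ite_true _ _ hp => obtain ⟨rfl, rfl⟩ := ih hp; exact ⟨rfl, rfl⟩
    | ite_false _ h' _ => exact absurd h' h
  | ite_false _ h _ ih =>
    cases h₂ with
    | ite_true _ h' _ => exact absurd h h'
    | ite_false _ _ hq => obtain ⟨rfl, rfl⟩ := ih hq; exact ⟨rfl, rfl⟩
  | while_true _ h _ _ ihp ihw =>
    cases h₂ with
    | while_true _ _ hp hw =>
      obtain ⟨rfl, rfl⟩ := ihp hp
      obtain ⟨rfl, rfl⟩ := ihw hw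
      exact ⟨rfl, rfl⟩
    | while_false _ h' => exact absurd h' h
  | while_false _ h =>
    cases h₂ with
    | while_true _ h' _ _ => exact absurd h h'
    | while_false => exact ⟨rfl, rfl⟩

end RAM

/-! ### The instance as the input of the machine -/

namespace DMC

/-- An entry as a number: `0`, `1`, and `2` for the missing entry. -/
def entryCode : Option Bool → ℕ
  | some false => 0
  | some true => 1
  | none => 2

/-- The initial state: `n`, `ℓ`, `α`, `β` in the registers `0`, `1`, `2`, `3`, the matrix row by row
in the memory cells `0, …, n * ℓ - 1`, and zeros elsewhere. -/
def input {n ℓ : ℕ} (S : PartialMatrix n ℓ) (α β : ℕ) : RAM.State where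
  reg x := if x = 0 then n else if x = 1 then ℓ else if x = 2 then α else if x = 3 then β else 0
  mem a := if h : a < n * ℓ then
      entryCode (S (Fin.divNat (n := ℓ) ⟨a, h⟩) (Fin.modNat (m := n) ⟨a, h⟩))
    else 0

end DMC

/-! A row has at most four completions, coded by the numbers below 4. Fix a completion `g` of the
last row. Two different completions of another row at the same distance from `g` have even distance
from each other, so they are complementary on the missing places, and no three are pairwise
different (`eq_or_eq_of_hammingDist_eq`). Hence every other row has in effect at most two values,
and the problem becomes a system of binary constraints like 2-SAT.

Subsets of a two-element set that meet pairwise have a common element. A row can therefore be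
eliminated without loss by recording, for each pair of later rows, whether one of its values suits
both and `g` (`satisfiable_succ_iff`). In the end a single table entry tells whether `g` extends to
a solution (`rel_iff_exists`), and the four choices of `g` are tried.

The distances of all pairs of completed rows cost `O(n²ℓ)`, the elimination `O(n³)`. For `α ≠ 0` an
equidistant binary code has at most `ℓ + 1` words (`card_le_of_equidistant`): a larger `n` means no,
and otherwise, for `n ≥ 2`, `n³` is `O(n²ℓ)`. For `α = 0` all rows must become equal, which is a
test on columns (`isYes_zero_iff`). For `n < 2` the answer is yes. -/

namespace RAM

/-! ### A program logic with time bounds -/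

/-- The registers that a program may assign. -/
def Prog.writes : Prog → List ℕ
  | .skip => []
  | .assign x _ => [x]
  | .store _ _ => []
  | .seq p q => p.writes ++ q.writes
  | .ite _ p q => p.writes ++ q.writes
  | .while _ p => p.writes

/-- The frame rule: register values are carried across a subprogram by a decidable check on a list.
-/
theorem Exec.reg_eq {B : ℕ} {p : Prog} {s s' : State} {t : ℕ} (h : Exec B p s t s') {x : ℕ}
    (hx : x ∉ p.writes) : s'.reg x = s.reg x := by
  induction h with
  | skip => rfl
  | assign s y e he =>
    have : x ≠ y := by simpa [Prog.writes] using hx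
    simp [this]
  | store => rfl
  | seq _ _ ihp ihq =>
    simp only [Prog.writes, List.mem_append, not_or] at hx
    rw [ihq hx.2, ihp hx.1]
  | ite_true _ _ _ ih =>
    simp only [Prog.writes, List.mem_append, not_or] at hx
    exact ih hx.1
  | ite_false _ _ _ ih =>
    simp only [Prog.writes, List.mem_append, not_or] at hx
    exact ih hx.2
  | while_true _ _ _ _ ihp ihw => rw [ihw hx, ihp hx]
  | while_false => rfl

/-- Started in `s`, the program `p` halts after at most `T` steps in a state that satisfies `Q`. -/
def Runs (B : ℕ) (p : Prog) (s : State) (T : ℕ) (Q : State → Prop) : Prop :=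
  ∃ t s', Exec B p s t s' ∧ t ≤ T ∧ Q s'

section rules

variable {B : ℕ} {p q : Prog} {s : State} {T T₁ T₂ : ℕ} {Q Q' : State → Prop} {e a : Expr}

/-- The consequence rule, with the frame rule built in: specifications need to mention only the
memory and the result registers. -/
theorem Runs.mono (h : Runs B p s T₁ Q) (hT : T₁ ≤ T)
    (hQ : ∀ s', (∀ x, x ∉ p.writes → s'.reg x = s.reg x) → Q s' → Q' s') : Runs B p s T Q' := by
  obtain ⟨t, s', he, ht, hq⟩ := h
  exact ⟨t, s', he, ht.trans hT, hQ s' (fun x hx => he.reg_eq hx) hq⟩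

theorem Runs.skip (hT : 1 ≤ T) (h : Q s) : Runs B .skip s T Q :=
  ⟨1, s, .skip s, hT, h⟩

theorem Runs.assign {x : ℕ} (he : e.Fits B s) (hT : e.cost + 1 ≤ T)
    (h : Q ⟨Function.update s.reg x (e.eval s), s.mem⟩) : Runs B (.assign x e) s T Q :=
  ⟨_, _, .assign s x e he, hT, h⟩

theorem Runs.store (ha : a.Fits B s) (he : e.Fits B s) (hT : a.cost + e.cost + 1 ≤ T)
    (h : Q ⟨s.reg, Function.update s.mem (a.eval s) (e.eval s)⟩) : Runs B (.store a e) s T Q :=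
  ⟨_, _, .store s a e ha he, hT, h⟩

theorem Runs.seq (T₁ T₂ : ℕ) (hT : T₁ + T₂ ≤ T)
    (h : Runs B p s T₁ fun s' => Runs B q s' T₂ Q) : Runs B (.seq p q) s T Q := by
  obtain ⟨t, s', he, ht, t', s'', he', ht', hq⟩ := h
  exact ⟨_, _, .seq he he', by omega, hq⟩

/-- The assignment of a register, followed by a program. -/
theorem Runs.assign_seq {x : ℕ} (T' : ℕ) (he : e.Fits B s) (hT : e.cost + 1 + T' ≤ T)
    (h : Runs B q ⟨Function.update s.reg x (e.eval s), s.mem⟩ T' Q) :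
    Runs B (.seq (.assign x e) q) s T Q :=
  Runs.seq _ _ hT (Runs.assign he le_rfl h)

theorem Runs.ite (T' : ℕ) (he : e.Fits B s) (hT : e.cost + 1 + T' ≤ T)
    (h₁ : e.eval s ≠ 0 → Runs B p s T' Q) (h₂ : e.eval s = 0 → Runs B q s T' Q) :
    Runs B (.ite e p q) s T Q := by
  by_cases h : e.eval s = 0
  · obtain ⟨t, s', hx, ht, hq⟩ := h₂ h
    exact ⟨_, _, .ite_false he h hx, by omega, hq⟩
  · obtain ⟨t, s', hx, ht, hq⟩ := h₁ h
    exact ⟨_, _, .ite_true he h hx, by omega, hq⟩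

end rules

/-- The loop `for x := 0, …, y - 1 do p` with the bound in the register `y`. -/
def forLoop (x y : ℕ) (p : Prog) : Prog :=
  .seq (.assign x (.lit 0))
    (.while (.sub (.reg y) (.reg x)) (.seq p (.assign x (.add (.reg x) (.lit 1)))))

theorem writes_forLoop (x y : ℕ) (p : Prog) :
    (forLoop x y p).writes = x :: (p.writes ++ [x]) := by
  simp [forLoop, Prog.writes]

/-- The invariant `I i` speaks of the state in which the counter is already `i`. Each round adds 4
steps for the test and 4 for the increment; the 6 is 2 for the initialisation plus 4 for the last
test. -/
theorem runs_forLoop {B x y N T : ℕ} {p : Prog} {s : State} (I : ℕ → State → Prop)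
    (hxy : x ≠ y) (hx : x ∉ p.writes) (hy : y ∉ p.writes) (hN : s.reg y = N) (hB : N + 1 ≤ B)
    (h0 : I 0 ⟨Function.update s.reg x 0, s.mem⟩)
    (hbody : ∀ i < N, ∀ s' : State, I i s' → s'.reg x = i →
      (∀ z, z ∉ x :: p.writes → s'.reg z = s.reg z) →
      Runs B p s' T fun s'' => I (i + 1) ⟨Function.update s''.reg x (i + 1), s''.mem⟩) :
    Runs B (forLoop x y p) s (N * (T + 8) + 6) (I N) := by
  -- Induction on the number `d` of remaining rounds.
  have key : ∀ d i, i + d = N → ∀ s' : State, I i s' → s'.reg x = i →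
      (∀ z, z ∉ x :: p.writes → s'.reg z = s.reg z) →
      Runs B (.while (.sub (.reg y) (.reg x)) (.seq p (.assign x (.add (.reg x) (.lit 1)))))
        s' (d * (T + 8) + 4) (I N) := by
    intro d
    induction d with
    | zero =>
      intro i hi s' hI hxi hf
      have hy' : s'.reg y = N := by rw [hf y (by simp [hy, hxy.symm]), hN]
      obtain rfl : i = N := hi
      refine ⟨_, s', .while_false ⟨?_, ?_⟩ ?_, ?_, hI⟩
      · simp only [Expr.Fits]; omega
      · simp only [Expr.Fits]; omega
      · simp only [Expr.eval]; omega
      · simp [Expr.cost]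
    | succ d ih =>
      intro i hi s' hI hxi hf
      have hy' : s'.reg y = N := by rw [hf y (by simp [hy, hxy.symm]), hN]
      obtain ⟨t, s'', he, ht, hI'⟩ := hbody i (by omega) s' hI hxi hf
      have hx'' : s''.reg x = i := by rw [he.reg_eq hx, hxi]
      obtain ⟨t', s₃, he', ht', hI₃⟩ := ih (i + 1) (by omega) _ hI' (by simp) (by
        intro z hz
        have hzx : z ≠ x := fun h => hz (by simp [h])
        have hzp : z ∉ p.writes := fun h => hz (by simp [h])
        simp only [Function.update_of_ne hzx]
        rw [he.reg_eq hzp, hf z hz])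
      refine ⟨_, s₃, .while_true (s₁ := ⟨Function.update s''.reg x (i + 1), s''.mem⟩)
        (t₁ := t + 4) ⟨?_, ?_⟩ ?_ (.seq he ?_) he', ?_, hI₃⟩
      · simp only [Expr.Fits]; omega
      · simp only [Expr.Fits]; omega
      · simp only [Expr.eval]; omega
      · have := Exec.assign (B := B) s'' x (.add (.reg x) (.lit 1))
          (by simp only [Expr.Fits, Expr.eval]; omega)
        simpa [Expr.cost, Expr.eval, hx''] using this
      · simp only [Expr.cost]
        have : (d + 1) * (T + 8) = d * (T + 8) + (T + 8) := by ring
        omega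
  refine Runs.assign_seq (N * (T + 8) + 4) (by simp [Expr.Fits]) (by simp [Expr.cost]; omega) ?_
  refine key N 0 (by simp) _ h0 (by simp [Expr.eval]) ?_
  intro z hz
  have hzx : z ≠ x := fun h => hz (by simp [h])
  simp [Function.update_of_ne hzx]

end RAM

namespace DMC

/-! ### Equidistant binary words -/

/-- At each place three bits give either no disagreeing pair or exactly two. -/
theorem even_hammingDist_add {ι : Type*} [Fintype ι] (x y z : ι → Bool) :
    Even (hammingDist x y + hammingDist x z + hammingDist y z) := by
  simp only [hammingDist, Finset.card_filter, ← Finset.sum_add_distrib]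
  refine Finset.even_sum _ fun i _ => ?_
  cases x i <;> cases y i <;> cases z i <;> decide

/-- Words that agree outside of a set of two places and have the same distance from `z` are equal
or complementary on that set. -/
theorem eq_not_of_hammingDist_eq {ι : Type*} [Fintype ι] [DecidableEq ι] {M : Finset ι}
    (hM : M.card ≤ 2) {f f' z : ι → Bool} (hne : f ≠ f') (hagree : ∀ j ∉ M, f j = f' j)
    (hd : hammingDist f z = hammingDist f' z) : ∀ j ∈ M, f' j = !f j := by
  have hsub : (Finset.univ.filter fun j => f j ≠ f' j) ⊆ M := by
    intro j hj
    by_contra h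
    exact (Finset.mem_filter.1 hj).2 (hagree j h)
  -- The distances to `z` are equal, so the distance of `f` and `f'` is even. Being positive it is
  -- at least 2, hence at least the size of `M`, and the two words differ on all of `M`.
  have hev := even_hammingDist_add f f' z
  have hpos : 0 < hammingDist f f' := hammingDist_pos.2 hne
  have hle : hammingDist f f' ≤ M.card := Finset.card_le_card hsub
  have hcard : M.card ≤ (Finset.univ.filter fun j => f j ≠ f' j).card := by
    change M.card ≤ hammingDist f f'
    rw [hd] at hev
    obtain ⟨r, hr⟩ := hev
    omega
  intro j hj
  rw [← Finset.eq_of_subset_of_card_le hsub hcard] at hj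
  have := (Finset.mem_filter.1 hj).2
  revert this
  cases f j <;> cases f' j <;> simp

/-- If `f'` and `f''` both differ from `f`, then both are the complement of `f` on `M` and so
coincide. This is what reduces four completions to two. -/
theorem eq_or_eq_of_hammingDist_eq {ι : Type*} [Fintype ι] [DecidableEq ι] {M : Finset ι}
    (hM : M.card ≤ 2) {f f' f'' z : ι → Bool} (h1 : ∀ j ∉ M, f j = f' j)
    (h2 : ∀ j ∉ M, f j = f'' j) {α : ℕ} (hf : hammingDist f z = α) (hf' : hammingDist f' z = α)
    (hf'' : hammingDist f'' z = α) : f = f' ∨ f = f'' ∨ f' = f'' := by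
  by_cases e1 : f = f'
  · exact Or.inl e1
  by_cases e2 : f = f''
  · exact Or.inr (Or.inl e2)
  refine Or.inr (Or.inr ?_)
  funext j
  by_cases hj : j ∈ M
  · rw [eq_not_of_hammingDist_eq hM e1 h1 (hf.trans hf'.symm) j hj,
      eq_not_of_hammingDist_eq hM e2 h2 (hf.trans hf''.symm) j hj]
  · rw [← h1 j hj, ← h2 j hj]

/-- An equidistant binary code with positive distance has at most one word more than its length. -/
theorem card_le_of_equidistant {n ℓ α : ℕ} (T : Fin n → Fin ℓ → Bool) (hα : α ≠ 0)
    (hT : ∀ i i', i ≠ i' → hammingDist (T i) (T i') = α) : n ≤ ℓ + 1 := by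
  obtain _ | n := n
  · omega
  -- The indicator vectors of the places where the other words differ from the first. Their Gram
  -- matrix is `α / 2` times the sum of the identity and the all-ones matrix, hence positive
  -- definite, so they are independent in dimension `ℓ`.
  let v : Fin n → Fin ℓ → ℝ := fun i j => if T i.succ j = T 0 j then 0 else 1
  have hv : ∀ i i', 2 * ∑ j, v i j * v i' j = (α : ℝ) + if i = i' then (α : ℝ) else 0 := by
    intro i i'
    have hpt : ∀ j, 2 * (v i j * v i' j) = (if T i.succ j ≠ T 0 j then (1 : ℝ) else 0)
        + (if T i'.succ j ≠ T 0 j then (1 : ℝ) else 0)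
        - (if T i.succ j ≠ T i'.succ j then (1 : ℝ) else 0) := by
      intro j
      simp only [v]
      cases T i.succ j <;> cases T i'.succ j <;> cases T 0 j <;> norm_num
    have hs : ∀ x y : Fin ℓ → Bool, ∑ j, (if x j ≠ y j then (1 : ℝ) else 0) = hammingDist x y := by
      intro x y
      exact Finset.sum_boole _ _
    rw [Finset.mul_sum, Finset.sum_congr rfl fun j _ => hpt j, Finset.sum_sub_distrib,
      Finset.sum_add_distrib, hs, hs, hs, hT _ _ (Fin.succ_ne_zero i), hT _ _ (Fin.succ_ne_zero i')]
    by_cases h : i = i'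
    · simp [h]
    · rw [hT _ _ (by simpa using h)]
      simp [h]
  have hli : LinearIndependent ℝ v := by
    rw [Fintype.linearIndependent_iff]
    intro c hc
    have h0 : 2 * ∑ j, (∑ i, c i * v i j) * (∑ i', c i' * v i' j) = 0 := by
      have : ∀ j, ∑ i, c i * v i j = 0 := by
        intro j
        have := congrFun hc j
        simpa using this
      simp [this]
    have h1 : 2 * ∑ j, (∑ i, c i * v i j) * (∑ i', c i' * v i' j)
        = ∑ i, ∑ i', c i * c i' * (2 * ∑ j, v i j * v i' j) := by
      simp only [Finset.mul_sum, Finset.sum_mul]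
      rw [Finset.sum_comm]
      refine (Finset.sum_congr rfl fun i _ => Finset.sum_comm).trans ?_
      rw [Finset.sum_comm]
      refine Finset.sum_congr rfl fun i _ => Finset.sum_congr rfl fun i' _ =>
        Finset.sum_congr rfl fun j _ => ?_
      ring
    have h2 : ∑ i, ∑ i', c i * c i' * (2 * ∑ j, v i j * v i' j)
        = (α : ℝ) * ((∑ i, c i) ^ 2 + ∑ i, c i ^ 2) := by
      simp only [hv, mul_add, Finset.sum_add_distrib, mul_ite, mul_zero, Finset.sum_ite_eq,
        Finset.mem_univ, if_true, ← Finset.sum_mul, ← Finset.mul_sum]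
      rw [sq, Finset.sum_mul_sum]
      simp only [sq, ← Finset.mul_sum, ← Finset.sum_mul]
      ring
    rw [h1, h2] at h0
    have hα' : (α : ℝ) ≠ 0 := by exact_mod_cast hα
    have h3 := (mul_eq_zero.1 h0).resolve_left hα'
    have h4 : ∑ i, c i ^ 2 = 0 := by
      have := Finset.sum_nonneg (s := Finset.univ) fun i _ => sq_nonneg (c i)
      nlinarith [sq_nonneg (∑ i, c i)]
    intro i
    have := (Finset.sum_eq_zero_iff_of_nonneg fun i _ => sq_nonneg (c i)).1 h4 i (Finset.mem_univ i)
    simpa using this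
  have := hli.fintype_card_le_finrank
  simp at this
  omega

/-! ### Elimination of variables -/

section elimination

variable {F : Type*} (d : F → F → ℕ) (α m : ℕ) (T : ℕ → ℕ → F) (g : F)

/-- The constraint between the choices `f` for the row `i` and `f'` for the row `j` after the
elimination of the rows before `k`. The choice for the row `m` is `g`. -/
def Rel : ℕ → ℕ → F → ℕ → F → Prop
  | 0, i, f, j, f' => i = j ∨ d f f' = α
  | k + 1, i, f, j, f' => Rel k i f j f' ∧ (k < i → k < j → ∃ c < 4,
      Rel k k (T k c) k (T k c) ∧ Rel k k (T k c) i f ∧ Rel k k (T k c) j f' ∧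
        Rel k k (T k c) m g)

theorem Rel.zero {d : F → F → ℕ} {α m : ℕ} {T : ℕ → ℕ → F} {g : F} {k i j : ℕ} {f f' : F}
    (h : Rel d α m T g k i f j f') : i = j ∨ d f f' = α := by
  induction k with
  | zero => exact h
  | succ k ih => exact ih h.1

/-- The constraints between the rows `k, …, m` are satisfied by a choice with `g` for `m`. -/
def Satisfiable (k : ℕ) : Prop :=
  ∃ x : ℕ → F, x m = g ∧ (∀ i, k ≤ i → i ≤ m → ∃ a < 4, x i = T i a) ∧
    ∀ i j, k ≤ i → i ≤ j → j ≤ m → Rel d α m T g k i (x i) j (x j)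

/-- From left to right the value of row `k` is the required witness. From right to left a value of
row `k` that suits all later rows is found from the values that suit two at a time, by a Helly
argument. -/
theorem satisfiable_succ_iff {k : ℕ} (hk : k < m)
    (helly : ∀ a < 4, ∀ b < 4, ∀ c < 4, d (T k a) g = α → d (T k b) g = α → d (T k c) g = α →
      T k a = T k b ∨ T k a = T k c ∨ T k b = T k c) :
    Satisfiable d α m T g k ↔ Satisfiable d α m T g (k + 1) := by
  constructor
  · rintro ⟨x, hm, hx, hR⟩
    refine ⟨x, hm, fun i hi => hx i (by omega), fun i j hi hij hj => ⟨hR i j (by omega) hij hj, ?_⟩⟩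
    intro _ _
    obtain ⟨c, hc, hxc⟩ := hx k le_rfl hk.le
    refine ⟨c, hc, ?_, ?_, ?_, ?_⟩
    · rw [← hxc]; exact hR k k le_rfl le_rfl hk.le
    · rw [← hxc]; exact hR k i le_rfl (by omega) (by omega)
    · rw [← hxc]; exact hR k j le_rfl (by omega) hj
    · have := hR k m le_rfl hk.le le_rfl
      rwa [hm, hxc] at this
  · rintro ⟨x, hm, hx, hR⟩
    -- The constraints are only available for ordered pairs of rows; this removes the order.
    have pair : ∀ i j, k + 1 ≤ i → i ≤ m → k + 1 ≤ j → j ≤ m → ∃ c < 4,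
        Rel d α m T g k k (T k c) k (T k c) ∧ Rel d α m T g k k (T k c) i (x i) ∧
          Rel d α m T g k k (T k c) j (x j) ∧ d (T k c) g = α := by
      intro i j hi him hj hjm
      have hd : ∀ c, Rel d α m T g k k (T k c) m g → d (T k c) g = α :=
        fun c h => h.zero.resolve_left (by omega)
      rcases le_total i j with hij | hij
      · obtain ⟨c, hc, h1, h2, h3, h4⟩ := (hR i j hi hij hjm).2 (by omega) (by omega)
        exact ⟨c, hc, h1, h2, h3, hd c h4⟩
      · obtain ⟨c, hc, h1, h2, h3, h4⟩ := (hR j i hj hij him).2 (by omega) (by omega)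
        exact ⟨c, hc, h1, h3, h2, hd c h4⟩
    -- Otherwise some row `i` rejects a value `a`, a value `b` accepted by `i` is rejected by some
    -- row `j`, and a value `c` is accepted by both. All three have distance `α` from `g`, so two of
    -- them coincide, and each coincidence contradicts a rejection.
    have hex : ∃ c < 4, Rel d α m T g k k (T k c) k (T k c) ∧
        ∀ j, k + 1 ≤ j → j ≤ m → Rel d α m T g k k (T k c) j (x j) := by
      by_contra hcon
      push Not at hcon
      obtain ⟨a, ha, a1, -, -, a2⟩ := pair m m (by omega) le_rfl (by omega) le_rfl
      obtain ⟨i, hi, him, hia⟩ := hcon a ha a1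
      obtain ⟨b, hb, b1, b2, -, b3⟩ := pair i i hi him hi him
      obtain ⟨j, hj, hjm, hjb⟩ := hcon b hb b1
      obtain ⟨c, hc, c1, c2, c3, c4⟩ := pair i j hi him hj hjm
      rcases helly a ha b hb c hc a2 b3 c4 with h | h | h
      · exact hia (h ▸ b2)
      · exact hia (h ▸ c2)
      · exact hjb (h ▸ c3)
    obtain ⟨c, hc, hcc, hcj⟩ := hex
    refine ⟨Function.update x k (T k c), ?_, ?_, ?_⟩
    · rw [Function.update_of_ne (by omega), hm]
    · intro i hi him
      by_cases h : i = k
      · subst h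
        exact ⟨c, hc, by simp⟩
      · rw [Function.update_of_ne h]
        exact hx i (by omega) him
    · intro i j hi hij hj
      by_cases h : i = k
      · subst h
        by_cases h' : j = i
        · subst h'
          simpa using hcc
        · rw [Function.update_self, Function.update_of_ne h']
          exact hcj j (by omega) hj
      · rw [Function.update_of_ne h, Function.update_of_ne (by omega)]
        exact (hR i j (by omega) hij hj).1

/-- Once the rows before `m` are gone, only the constraint of row `m` with itself is left. The round
for `m` itself changes nothing, as `m < m` fails; it is counted so that the machine may run over all
rows. -/
theorem rel_iff_exists {a₀ : ℕ} (ha₀ : a₀ < 4) (hg : g = T m a₀)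
    (helly : ∀ k < m, ∀ a < 4, ∀ b < 4, ∀ c < 4, d (T k a) g = α → d (T k b) g = α →
      d (T k c) g = α → T k a = T k b ∨ T k a = T k c ∨ T k b = T k c) :
    Rel d α m T g (m + 1) m g m g ↔ ∃ x : ℕ → F, x m = g ∧ (∀ i ≤ m, ∃ a < 4, x i = T i a) ∧
      ∀ i j, i < j → j ≤ m → d (x i) (x j) = α := by
  have h1 : ∀ k ≤ m, (Satisfiable d α m T g 0 ↔ Satisfiable d α m T g k) := by
    intro k
    induction k with
    | zero => simp
    | succ k ih =>
      intro hk
      rw [ih (by omega), satisfiable_succ_iff d α m T g (by omega) (helly k (by omega))]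
  have h2 : Rel d α m T g (m + 1) m g m g ↔ Satisfiable d α m T g m := by
    constructor
    · rintro ⟨h, -⟩
      refine ⟨fun _ => g, rfl, ?_, ?_⟩
      · intro i hi him
        obtain rfl : i = m := by omega
        exact ⟨a₀, ha₀, hg⟩
      · intro i j hi hij hj
        obtain rfl : i = m := by omega
        obtain rfl : j = i := by omega
        exact h
    · rintro ⟨x, hm, -, h⟩
      refine ⟨?_, fun h => absurd h (lt_irrefl m)⟩
      have := h m m le_rfl le_rfl le_rfl
      rwa [hm] at this
  rw [h2, ← h1 m le_rfl]
  constructor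
  · rintro ⟨x, hm, hx, h⟩
    exact ⟨x, hm, fun i => hx i (Nat.zero_le i), fun i j hij hj =>
      (h i j (Nat.zero_le i) hij.le hj).resolve_left hij.ne⟩
  · rintro ⟨x, hm, hx, h⟩
    refine ⟨x, hm, fun i _ => hx i, fun i j _ hij hj => ?_⟩
    rcases hij.eq_or_lt with e | e
    · exact Or.inl e
    · exact Or.inr (h i j e hj)

end elimination

end DMC

namespace DMC

/-! ### The completions of a row -/

/-- The entry of an instance in the row `i` and the column `j` as a number. -/
def code {n ℓ : ℕ} (S : PartialMatrix n ℓ) (i j : ℕ) : ℕ :=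
  if h : i < n ∧ j < ℓ then entryCode (S ⟨i, h.1⟩ ⟨j, h.2⟩) else 0

theorem code_le {n ℓ : ℕ} (S : PartialMatrix n ℓ) (i j : ℕ) : code S i j ≤ 2 := by
  unfold code
  split
  · rcases S _ _ with _ | _ | _ <;> simp [entryCode]
  · simp

theorem code_val {n ℓ : ℕ} (S : PartialMatrix n ℓ) (i : Fin n) (j : Fin ℓ) :
    code S i j = entryCode (S i j) := by
  simp [code]

theorem entryCode_eq_two {o : Option Bool} : entryCode o = 2 ↔ o = none := by
  rcases o with _ | _ | _ <;> simp [entryCode]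

/-- The number of missing entries among the first `j` entries of a row. -/
def missing (r : ℕ → ℕ) (j : ℕ) : ℕ := Nat.count (fun j => r j = 2) j

/-- The entry `j` of the row `r` when its missing entries are replaced by the binary digits of
`a`. -/
def fill (r : ℕ → ℕ) (a j : ℕ) : ℕ :=
  if r j = 2 then a / 2 ^ missing r j % 2 else r j

theorem fill_le {r : ℕ → ℕ} (hr : ∀ j, r j ≤ 2) (a j : ℕ) : fill r a j ≤ 1 := by
  unfold fill
  have := hr j
  split <;> omega

/-- The row `i` with its missing entries replaced by the binary digits of `a`. -/
def fillRow {n ℓ : ℕ} (S : PartialMatrix n ℓ) (i a : ℕ) : Fin ℓ → Bool :=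
  fun j => decide (fill (code S i) a j = 1)

/-- The sum of both truncated differences is the absolute difference, which is how the machine
computes it. -/
theorem hammingDist_fillRow {n ℓ : ℕ} (S : PartialMatrix n ℓ) (i a i' a' : ℕ) :
    hammingDist (fillRow S i a) (fillRow S i' a') = ∑ j ∈ Finset.range ℓ,
      ((fill (code S i) a j - fill (code S i') a' j)
        + (fill (code S i') a' j - fill (code S i) a j)) := by
  rw [hammingDist, Finset.card_filter, Finset.sum_range]
  refine Finset.sum_congr rfl fun j _ => ?_
  have h1 := fill_le (code_le S i) a j
  have h2 := fill_le (code_le S i') a' j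
  have key : ∀ x ≤ 1, ∀ y ≤ 1,
      (if decide (x = 1) ≠ decide (y = 1) then 1 else 0) = (x - y) + (y - x) := by
    intro x hx y hy
    interval_cases x <;> interval_cases y <;> simp
  convert key _ h1 _ h2 <;> rfl

theorem fillRow_eq {n ℓ : ℕ} (S : PartialMatrix n ℓ) (i : Fin n) (a : ℕ) (j : Fin ℓ) {b : Bool}
    (h : S i j = some b) : fillRow S i a j = b := by
  have hc := code_val S i j
  rw [h] at hc
  cases b <;> simp [fillRow, fill, hc, entryCode]

theorem missing_le_of_maxMissing_le {n ℓ : ℕ} {S : PartialMatrix n ℓ} (hS : maxMissing S ≤ 2)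
    (i : Fin n) : missing (code S i) ℓ ≤ 2 := by
  have h : (Finset.univ.filter fun j : Fin ℓ => S i j = none).card ≤ 2 :=
    (Finset.le_sup (f := fun i : Fin n => (Finset.univ.filter fun j : Fin ℓ => S i j = none).card)
      (Finset.mem_univ i)).trans hS
  have e : missing (code S i) ℓ = (Finset.univ.filter fun j : Fin ℓ => S i j = none).card := by
    rw [missing, Nat.count_eq_card_filter_range, Finset.card_filter, Finset.sum_range,
      Finset.card_filter]
    refine Finset.sum_congr rfl fun j _ => ?_
    simp only [code_val, entryCode_eq_two]
  omega

theorem exists_fillRow_eq {n ℓ : ℕ} {S : PartialMatrix n ℓ} (hS : maxMissing S ≤ 2) (i : Fin n)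
    (f : Fin ℓ → Bool) (hf : ∀ j, S i j = none ∨ S i j = some (f j)) :
    ∃ a < 4, f = fillRow S i a := by
  classical
  have hM := missing_le_of_maxMissing_le hS i
  -- The value of `f` at the missing place number `m`, and 0 if there is no such place.
  let b : ℕ → ℕ := fun m => if ∃ j : Fin ℓ, S i j = none ∧ missing (code S i) j = m ∧ f j = true
    then 1 else 0
  have hb : ∀ m, b m ≤ 1 := by
    intro m
    simp only [b]
    split <;> omega
  have hb0 := hb 0
  have hb1 := hb 1
  refine ⟨b 0 + 2 * b 1, by omega, ?_⟩
  funext j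
  rcases hf j with h | h
  · have hc : code S i j = 2 := by rw [code_val, h]; rfl
    have hlt : missing (code S i) j < 2 := by
      have : missing (code S i) (j + 1) ≤ missing (code S i) ℓ := Nat.count_monotone _ j.2
      have h' : missing (code S i) (j + 1) = missing (code S i) j + 1 := by
        simp [missing, Nat.count_succ, hc]
      omega
    have hdig : (b 0 + 2 * b 1) / 2 ^ missing (code S i) j % 2 = b (missing (code S i) j) := by
      generalize missing (code S i) j = m at hlt
      interval_cases m
      · simp only [pow_zero, Nat.div_one]; omega
      · simp only [pow_one]; omega
    have hbf : b (missing (code S i) j) = 1 ↔ f j = true := by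
      simp only [b]
      constructor
      · intro h1
        by_contra hfj
        rw [if_neg] at h1
        · simp at h1
        · rintro ⟨j', hj', hcount, hfj'⟩
          -- A missing place is determined by the number of missing places before it.
          have : (j' : ℕ) = j := by
            refine Nat.count_injective (p := fun j => code S i j = 2) ?_ hc hcount
            rw [code_val, hj']; rfl
          rw [Fin.ext this] at hfj'
          exact hfj hfj'
      · intro h1
        rw [if_pos ⟨j, h, rfl, h1⟩]
    simp only [fillRow, fill, hc, if_true, hdig]
    cases hfj : f j
    · simp [hbf, hfj]
    · simp [hbf, hfj]
  · rw [fillRow_eq S i _ j h]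

theorem isYes_iff {n ℓ : ℕ} (S : PartialMatrix n ℓ) (α : ℕ) :
    IsYes S α α ↔ ∃ T : Matrix (Fin n) (Fin ℓ) Bool, IsCompletion S T ∧
      ∀ i i', i ≠ i' → hammingDist (T i) (T i') = α := by
  unfold IsYes minDist maxDist
  refine exists_congr fun T => and_congr_right fun _ => ?_
  simp only [le_iInf_iff, iSup_le_iff, Nat.cast_le]
  constructor
  · rintro ⟨h1, h2⟩ i i' h
    exact le_antisymm (h2 i i' h) (h1 i i' h)
  · intro h
    exact ⟨fun i i' hi => (h i i' hi).ge, fun i i' hi => (h i i' hi).le⟩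

theorem exists_isCompletion {n ℓ : ℕ} (S : PartialMatrix n ℓ) : ∃ T, IsCompletion S T := by
  refine ⟨fun i j => (S i j).getD false, fun i j => ?_⟩
  rcases h : S i j with _ | v
  · exact Or.inl rfl
  · simp [h]

theorem isYes_of_le_one {n ℓ : ℕ} (hn : n < 2) (S : PartialMatrix n ℓ) (α : ℕ) :
    IsYes S α α := by
  obtain ⟨T, hT⟩ := exists_isCompletion S
  exact (isYes_iff S α).2 ⟨T, hT, fun i i' h => absurd (Fin.ext (by omega)) h⟩

/-- Distance 0 makes all rows equal, and a common row exists unless some column contains both bits.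
-/
theorem isYes_zero_iff {n ℓ : ℕ} (S : PartialMatrix n ℓ) : IsYes S 0 0 ↔
    ∀ j < ℓ, ∀ i < n, ∀ i' < n, ¬ (code S i j = 0 ∧ code S i' j = 1) := by
  rw [isYes_iff]
  have h0 : ∀ {o : Option Bool}, entryCode o = 0 ↔ o = some false := by
    intro o; rcases o with _ | _ | _ <;> simp [entryCode]
  have h1 : ∀ {o : Option Bool}, entryCode o = 1 ↔ o = some true := by
    intro o; rcases o with _ | _ | _ <;> simp [entryCode]
  constructor
  · rintro ⟨T, hT, hd⟩ j hj i hi i' hi' ⟨e0, e1⟩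
    have c0 := code_val S ⟨i, hi⟩ ⟨j, hj⟩
    have c1 := code_val S ⟨i', hi'⟩ ⟨j, hj⟩
    rw [e0, eq_comm, h0] at c0
    rw [e1, eq_comm, h1] at c1
    have t0 := hT ⟨i, hi⟩ ⟨j, hj⟩
    have t1 := hT ⟨i', hi'⟩ ⟨j, hj⟩
    rw [c0] at t0
    rw [c1] at t1
    simp only [reduceCtorEq, false_or, Option.some.injEq] at t0 t1
    by_cases h : (⟨i, hi⟩ : Fin n) = ⟨i', hi'⟩
    · rw [← h, ← t0] at t1
      simp at t1
    · have := congrFun (hammingDist_eq_zero.1 (hd _ _ h)) ⟨j, hj⟩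
      rw [← t0, ← t1] at this
      simp at this
  · intro h
    classical
    -- The common row has a one exactly where some row prescribes it; columns that are entirely
    -- missing get a zero.
    refine ⟨fun _ j => decide (∃ i, S i j = some true), fun i j => ?_, fun i i' _ => ?_⟩
    · rcases hs : S i j with _ | _ | _
      · simp
      · right
        refine congrArg some (eq_comm.1 (decide_eq_false ?_))
        rintro ⟨i', hs'⟩
        refine h j j.2 i i.2 i' i'.2 ⟨?_, ?_⟩
        · rw [code_val, h0, hs]
        · rw [code_val, h1, hs']
      · right
        exact congrArg some (eq_comm.1 (decide_eq_true ⟨i, hs⟩))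
    · simp

theorem not_isYes_of_lt {n ℓ α : ℕ} (hα : α ≠ 0) (hn : ℓ + 1 < n) (S : PartialMatrix n ℓ) :
    ¬ IsYes S α α := by
  rw [isYes_iff]
  rintro ⟨T, -, hd⟩
  have := card_le_of_equidistant T hα hd
  omega

theorem fillRow_helly {n ℓ α : ℕ} {S : PartialMatrix n ℓ} (hS : maxMissing S ≤ 2)
    (g : Fin ℓ → Bool) {i : ℕ} (hi : i < n) (a b c : ℕ)
    (ha : hammingDist (fillRow S i a) g = α) (hb : hammingDist (fillRow S i b) g = α)
    (hc : hammingDist (fillRow S i c) g = α) :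
    fillRow S i a = fillRow S i b ∨ fillRow S i a = fillRow S i c
      ∨ fillRow S i b = fillRow S i c := by
  have hM : (Finset.univ.filter fun j : Fin ℓ => S ⟨i, hi⟩ j = none).card ≤ 2 :=
    (Finset.le_sup (f := fun i : Fin n => (Finset.univ.filter fun j : Fin ℓ => S i j = none).card)
      (Finset.mem_univ ⟨i, hi⟩)).trans hS
  have hag : ∀ a b, ∀ j ∉ (Finset.univ.filter fun j : Fin ℓ => S ⟨i, hi⟩ j = none),
      fillRow S i a j = fillRow S i b j := by
    intro a b j hj
    have hj' : S ⟨i, hi⟩ j ≠ none := fun h => hj (by simp [h])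
    obtain ⟨v, hv⟩ := Option.ne_none_iff_exists'.1 hj'
    rw [fillRow_eq S ⟨i, hi⟩ a j hv, fillRow_eq S ⟨i, hi⟩ b j hv]
  exact eq_or_eq_of_hammingDist_eq hM (hag a b) (hag a c) ha hb hc

/-- The number `a` is the guess for the last row; it supplies the reference word `g`. -/
theorem isYes_iff_rel {n ℓ : ℕ} {S : PartialMatrix n ℓ} (hS : maxMissing S ≤ 2) (hn : 0 < n)
    (α : ℕ) : IsYes S α α ↔ ∃ a < 4,
      Rel hammingDist α (n - 1) (fillRow S) (fillRow S (n - 1) a) n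
        (n - 1) (fillRow S (n - 1) a) (n - 1) (fillRow S (n - 1) a) := by
  obtain ⟨m, rfl⟩ : ∃ m, n = m + 1 := ⟨n - 1, by omega⟩
  rw [isYes_iff]
  simp only [Nat.add_sub_cancel]
  constructor
  · rintro ⟨T, hT, hd⟩
    obtain ⟨a, ha, hTa⟩ := exists_fillRow_eq hS ⟨m, by omega⟩ (T ⟨m, by omega⟩) (hT _)
    refine ⟨a, ha, ?_⟩
    rw [rel_iff_exists hammingDist α m (fillRow S) _ ha rfl
      fun k hk a _ b _ c _ => fillRow_helly hS _ (by omega) a b c]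
    refine ⟨fun i => if h : i < m + 1 then T ⟨i, h⟩ else fun _ => false, ?_, ?_, ?_⟩
    · simp [hTa]
    · intro i hi
      obtain ⟨b, hb, hTb⟩ := exists_fillRow_eq hS ⟨i, by omega⟩ (T ⟨i, by omega⟩) (hT _)
      exact ⟨b, hb, (dif_pos (by omega)).trans hTb⟩
    · intro i j hij hj
      simp only
      rw [dif_pos (by omega), dif_pos (by omega)]
      exact hd _ _ (by simp; omega)
  · rintro ⟨a, ha, h⟩
    rw [rel_iff_exists hammingDist α m (fillRow S) _ ha rfl
      fun k hk a _ b _ c _ => fillRow_helly hS _ (by omega) a b c] at h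
    obtain ⟨x, -, hx, hd⟩ := h
    refine ⟨fun i => x i, fun i j => ?_, fun i i' hii => ?_⟩
    · obtain ⟨b, -, hb⟩ := hx i (by omega)
      rcases hs : S i j with _ | v
      · exact Or.inl rfl
      · right
        exact congrArg some ((congrFun hb j).trans (fillRow_eq S i b j hs)).symm
    · rcases lt_or_gt_of_ne (fun h => hii (Fin.ext h) : (i : ℕ) ≠ i') with h | h
      · exact hd i i' h (by omega)
      · rw [hammingDist_comm]
        exact hd i' i h (by omega)

end DMC

namespace DMC

open RAM

/-! ### The distance of two completed rows -/

/-- The memory holds the entries of the instance. -/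
def HasMatrix {n ℓ : ℕ} (S : PartialMatrix n ℓ) (mem : ℕ → ℕ) : Prop :=
  ∀ i < n, ∀ j < ℓ, mem (i * ℓ + j) = code S i j

theorem mul_add_lt {n ℓ i j : ℕ} (hi : i < n) (hj : j < ℓ) : i * ℓ + j < n * ℓ := by
  have : (i + 1) * ℓ ≤ n * ℓ := Nat.mul_le_mul_right _ hi
  rw [Nat.succ_mul] at this
  omega

/-- Half of a number in the register `r` that is at most three. -/
def half (r : ℕ) : Expr := .sub (.sub (.reg r) (.lit 1)) (.sub (.reg r) (.lit 2))

/-- The register `x` receives the next entry of the completed row whose start is in the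
register `base`, with the digits for the missing entries in the register `a`. -/
def readEntry (x base a c : ℕ) : Prog :=
  .seq (.assign x (.mem (.add (.reg base) (.reg c))))
    (.ite (.sub (.reg x) (.lit 1))
      (.seq (.assign x (.sub (.reg a) (.mul (.lit 2) (half a)))) (.assign a (half a))) .skip)

/-- The register `a` is halved at each missing entry, so its lowest bit is always the digit for the
next one. There is no division, but `half` is correct for numbers below 4. -/
theorem runs_readEntry {B x base a c o j : ℕ} {r : ℕ → ℕ} {s : State} (hxa : a ≠ x) (hB : 8 ≤ B)
    (hr : r j ≤ 2) (ho : o < 4) (hbc : s.reg base + s.reg c ≤ B)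
    (hm : s.mem (s.reg base + s.reg c) = r j) (ha : s.reg a = o / 2 ^ missing r j) :
    Runs B (readEntry x base a c) s 30 fun s' => s'.mem = s.mem ∧ s'.reg x = fill r o j ∧
      s'.reg a = o / 2 ^ missing r (j + 1) := by
  have hlt : o / 2 ^ missing r j < 4 := (Nat.div_le_self _ _).trans_lt ho
  refine Runs.assign_seq 24 ?_ (by simp [Expr.cost]) ?_
  · simp only [Expr.Fits, Expr.eval, hm]
    omega
  · simp only [Expr.eval, hm]
    refine Runs.ite 20 ?_ (by simp [Expr.cost]) ?_ ?_
    · simp only [Expr.Fits, Function.update_self]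
      omega
    · intro h
      have h2 : r j = 2 := by
        simp only [Expr.eval, Function.update_self] at h
        omega
      refine Runs.assign_seq 8 ?_ (by simp [Expr.cost, half]) ?_
      · simp only [Expr.Fits, Expr.eval, half, Function.update_of_ne hxa, ha]
        omega
      · refine Runs.assign ?_ (by simp [Expr.cost, half]) ?_
        · simp only [Expr.Fits, half, Function.update_of_ne hxa, ha]
          omega
        · have hmi : missing r (j + 1) = missing r j + 1 := by
            simp [missing, Nat.count_succ, h2]
          simp only [Expr.eval, half, Function.update_of_ne hxa, Function.update_of_ne hxa.symm,
            Function.update_self, ha, fill, h2, hmi, pow_succ, ← Nat.div_div_eq_div_mul, if_true,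
            true_and]
          generalize o / 2 ^ missing r j = q at hlt
          omega
    · intro h
      have h2 : r j ≠ 2 := by
        simp only [Expr.eval, Function.update_self] at h
        omega
      have hmi : missing r (j + 1) = missing r j := by
        simp [missing, Nat.count_succ, h2]
      refine Runs.skip (by simp) ?_
      simp [fill, h2, hmi, hxa, ha]

/-- The register `29` receives the distance of the completed rows whose starts are in the registers
`20` and `22`, with the digits for the missing entries in the registers `21` and `23`. -/
def distProg : Prog :=
  .seq (.assign 29 (.lit 0)) (forLoop 24 1 (.seq (readEntry 27 20 21 24)
    (.seq (readEntry 28 22 23 24) (.assign 29 (.add (.reg 29)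
      (.add (.sub (.reg 27) (.reg 28)) (.sub (.reg 28) (.reg 27))))))))

theorem runs_distProg {B n ℓ i a j b : ℕ} {S : PartialMatrix n ℓ} {s : State}
    (hB : n * ℓ + ℓ + 8 ≤ B) (hi : i < n) (hj : j < n) (ha : a < 4) (hb : b < 4)
    (hS : HasMatrix S s.mem) (h1 : s.reg 1 = ℓ) (h20 : s.reg 20 = i * ℓ) (h21 : s.reg 21 = a)
    (h22 : s.reg 22 = j * ℓ) (h23 : s.reg 23 = b) :
    Runs B distProg s (ℓ * 78 + 8) fun s' => s'.mem = s.mem ∧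
      s'.reg 29 = hammingDist (fillRow S i a) (fillRow S j b) := by
  rw [hammingDist_fillRow]
  refine Runs.assign_seq (ℓ * 78 + 6) (by simp [Expr.Fits]) (by simp [Expr.cost]; omega) ?_
  refine (runs_forLoop (N := ℓ) (T := 70) (fun c s' => s'.mem = s.mem ∧
    s'.reg 29 = ∑ j' ∈ Finset.range c, ((fill (code S i) a j' - fill (code S j) b j')
        + (fill (code S j) b j' - fill (code S i) a j')) ∧
    s'.reg 21 = a / 2 ^ missing (code S i) c ∧ s'.reg 23 = b / 2 ^ missing (code S j) c)
    (by decide) (by decide) (by decide) (by simp [h1]) (by omega) ?_ ?_).mono le_rfl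
    fun s' _ h => ⟨h.1, h.2.1⟩
  · simp [h21, h23, Expr.eval, missing]
  · rintro c hc s₁ ⟨hm, hd, ha', hb'⟩ hc' hf
    have f20 : s₁.reg 20 = i * ℓ := by rw [hf 20 (by decide)]; simpa using h20
    have f22 : s₁.reg 22 = j * ℓ := by rw [hf 22 (by decide)]; simpa using h22
    have hlt := mul_add_lt hi hc
    have hlt' := mul_add_lt hj hc
    have hx := fill_le (code_le S i) a c
    have hy := fill_le (code_le S j) b c
    have hsum : ∑ j' ∈ Finset.range c, ((fill (code S i) a j' - fill (code S j) b j')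
        + (fill (code S j) b j' - fill (code S i) a j')) ≤ c := by
      refine (Finset.sum_le_card_nsmul _ _ 1 fun j' _ => ?_).trans (by simp)
      have := fill_le (code_le S i) a j'
      have := fill_le (code_le S j) b j'
      omega
    refine Runs.seq 30 40 le_rfl ((runs_readEntry (r := code S i) (j := c) (o := a) (by decide)
      (by omega) (code_le S i c) ha (by rw [f20, hc']; omega)
      (by rw [f20, hc', hm]; exact hS i hi c hc) ha').mono le_rfl ?_)
    rintro s₂ hf₂ ⟨hm₂, hx₂, ha₂⟩
    have g (z : ℕ) (hz : z ∉ (readEntry 27 20 21 24).writes) := hf₂ z hz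
    refine Runs.seq 30 10 le_rfl ((runs_readEntry (r := code S j) (j := c) (o := b) (by decide)
      (by omega) (code_le S j c) hb (by rw [g 22 (by decide), g 24 (by decide), f22, hc']; omega)
      (by rw [g 22 (by decide), g 24 (by decide), f22, hc', hm₂, hm]; exact hS j hj c hc)
      (by rw [g 23 (by decide), hb'])).mono le_rfl ?_)
    rintro s₃ hf₃ ⟨hm₃, hy₃, hb₃⟩
    have e29 : s₃.reg 29 = s₁.reg 29 := by rw [hf₃ 29 (by decide), g 29 (by decide)]
    have e27 : s₃.reg 27 = fill (code S i) a c := by rw [hf₃ 27 (by decide), hx₂]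
    have e21 : s₃.reg 21 = a / 2 ^ missing (code S i) (c + 1) := by
      rw [hf₃ 21 (by decide), ha₂]
    refine Runs.assign ?_ (by simp [Expr.cost]) ?_
    · simp only [Expr.Fits, Expr.eval, e29, e27, hy₃, hd]
      omega
    · simp [Expr.eval, e29, e27, hy₃, hd, hm₃, hm₂, hm, e21, hb₃, Finset.sum_range_succ]

/-! ### Loops over all pairs of completed rows -/

/-- The place of a pair of completed rows in a table. -/
def idx (n i a j b : ℕ) : ℕ := (4 * i + a) * (4 * n) + (4 * j + b)

theorem idx_lt {n i a j b : ℕ} (hi : i < n) (ha : a < 4) (hj : j < n) (hb : b < 4) :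
    idx n i a j b < 16 * n * n := by
  have := mul_add_lt (n := 4 * n) (ℓ := 4 * n) (i := 4 * i + a) (j := 4 * j + b)
    (by omega) (by omega)
  have e : 16 * n * n = 4 * n * (4 * n) := by ring
  rw [e]
  exact this

theorem idx_inj {n i a j b i' a' j' b' : ℕ} (ha : a < 4) (hj : j < n) (hb : b < 4) (ha' : a' < 4)
    (hj' : j' < n) (hb' : b' < 4) (h : idx n i a j b = idx n i' a' j' b') :
    i = i' ∧ a = a' ∧ j = j' ∧ b = b' := by
  have h1 : (idx n i a j b) / (4 * n) = 4 * i + a := by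
    rw [idx, mul_comm, Nat.mul_add_div (by omega), Nat.div_eq_of_lt (by omega)]
    rfl
  have h2 : (idx n i' a' j' b') / (4 * n) = 4 * i' + a' := by
    rw [idx, mul_comm, Nat.mul_add_div (by omega), Nat.div_eq_of_lt (by omega)]
    rfl
  have h3 : (idx n i a j b) % (4 * n) = 4 * j + b := by
    rw [idx, mul_comm, Nat.mul_add_mod, Nat.mod_eq_of_lt (by omega)]
  have h4 : (idx n i' a' j' b') % (4 * n) = 4 * j' + b' := by
    rw [idx, mul_comm, Nat.mul_add_mod, Nat.mod_eq_of_lt (by omega)]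
  rw [h] at h1 h3
  omega

/-- A loop over all pairs of completed rows, in the registers `8`, `9` and `10`, `11`. -/
def forPairs (p : Prog) : Prog := forLoop 8 0 (forLoop 9 4 (forLoop 10 0 (forLoop 11 4 p)))

/-- The four nested loops visit the pairs in the order of `idx`, so one invariant `J`, depending on
the position and the memory, serves all of them. -/
theorem runs_forPairs {B n T : ℕ} {p : Prog} {s : State} (J : ℕ → (ℕ → ℕ) → Prop)
    (hp : ∀ z ∈ [0, 4, 8, 9, 10, 11], z ∉ p.writes) (hB : n + 8 ≤ B) (hn : 0 < n)
    (h0 : s.reg 0 = n) (h4 : s.reg 4 = 4) (hJ : J 0 s.mem)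
    (hbody : ∀ i < n, ∀ a < 4, ∀ j < n, ∀ b < 4, ∀ s' : State, J (idx n i a j b) s'.mem →
      s'.reg 8 = i → s'.reg 9 = a → s'.reg 10 = j → s'.reg 11 = b →
      (∀ z, z ∉ 8 :: 9 :: 10 :: 11 :: p.writes → s'.reg z = s.reg z) →
      Runs B p s' T fun s'' => J (idx n i a j b + 1) s''.mem) :
    Runs B (forPairs p) s (n ^ 2 * (16 * T + 260)) fun s' => J (16 * n * n) s'.mem := by
  have p0 := hp 0 (by simp)
  have p4 := hp 4 (by simp)
  have p8 := hp 8 (by simp)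
  have p9 := hp 9 (by simp)
  have p10 := hp 10 (by simp)
  have p11 := hp 11 (by simp)
  refine (runs_forLoop (N := n) (T := 4 * ((n * ((4 * (T + 8) + 6) + 8) + 6) + 8) + 6)
    (fun i s' => J (i * (16 * n)) s'.mem) (by decide) ?_ ?_ h0 (by omega) ?_ ?_).mono ?_ ?_
  · simp [writes_forLoop, p8]
  · simp [writes_forLoop, p0]
  · simpa using hJ
  · intro i hi s₁ hJ₁ r8 hf₁
    refine (runs_forLoop (N := 4) (T := n * ((4 * (T + 8) + 6) + 8) + 6)
      (fun a s' => J ((4 * i + a) * (4 * n)) s'.mem) (by decide) ?_ ?_ ?_ (by omega) ?_ ?_).mono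
      le_rfl ?_
    · simp [writes_forLoop, p9]
    · simp [writes_forLoop, p4]
    · rw [hf₁ 4 (by simp [writes_forLoop, p4]), h4]
    · convert hJ₁ using 1; ring
    · intro a ha s₂ hJ₂ r9 hf₂
      refine (runs_forLoop (N := n) (T := 4 * (T + 8) + 6)
        (fun j s' => J ((4 * i + a) * (4 * n) + 4 * j) s'.mem) (by decide) ?_ ?_ ?_ (by omega)
        ?_ ?_).mono le_rfl ?_
      · simp [writes_forLoop, p10]
      · simp [writes_forLoop, p0]
      · rw [hf₂ 0 (by simp [writes_forLoop, p0]), hf₁ 0 (by simp [writes_forLoop, p0]), h0]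
      · exact hJ₂
      · intro j hj s₃ hJ₃ r10 hf₃
        refine (runs_forLoop (N := 4) (T := T)
          (fun b s' => J ((4 * i + a) * (4 * n) + (4 * j + b)) s'.mem) (by decide) p11 p4 ?_
          (by omega) ?_ ?_).mono le_rfl ?_
        · rw [hf₃ 4 (by simp [writes_forLoop, p4]), hf₂ 4 (by simp [writes_forLoop, p4]),
            hf₁ 4 (by simp [writes_forLoop, p4]), h4]
        · exact hJ₃
        · intro b hb s₄ hJ₄ r11 hf₄
          refine hbody i hi a ha j hj b hb s₄ hJ₄ ?_ ?_ ?_ r11 ?_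
          · rw [hf₄ 8 (by simp [p8]), hf₃ 8 (by simp [writes_forLoop, p8]),
              hf₂ 8 (by simp [writes_forLoop, p8]), r8]
          · rw [hf₄ 9 (by simp [p9]), hf₃ 9 (by simp [writes_forLoop, p9]), r9]
          · rw [hf₄ 10 (by simp [p10]), r10]
          · intro z hz
            simp only [List.mem_cons, not_or] at hz
            rw [hf₄ z (by simp [hz]), hf₃ z (by simp [writes_forLoop, hz]),
              hf₂ z (by simp [writes_forLoop, hz]), hf₁ z (by simp [writes_forLoop, hz])]
        · intro s' _ h
          convert h using 1; ring
      · intro s' _ h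
        convert h using 1; ring
    · intro s' _ h
      convert h using 1; ring
  -- The exact bound is `n²(16T + 184) + 70n + 6`, and `184 + 70 + 6 = 260`.
  · nlinarith
  · intro s' _ h
    convert h using 1; ring

end DMC

namespace DMC

open RAM

/-! ### The table of the constraints -/

open Classical in
/-- The memory holds the table of the relation `Q` on the pairs of completed rows before place
`t`. -/
def HasTable (n ℓ t : ℕ) (Q : ℕ → ℕ → ℕ → ℕ → Prop) (mem : ℕ → ℕ) : Prop :=
  ∀ i < n, ∀ a < 4, ∀ j < n, ∀ b < 4, idx n i a j b < t →
    mem (n * ℓ + idx n i a j b) = if Q i a j b then 1 else 0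

theorem HasMatrix.update {n ℓ w v : ℕ} {S : PartialMatrix n ℓ} {mem : ℕ → ℕ}
    (h : HasMatrix S mem) : HasMatrix S (Function.update mem (n * ℓ + w) v) := by
  intro i hi j hj
  have := mul_add_lt hi hj
  rw [Function.update_of_ne (by omega)]
  exact h i hi j hj

/-- Serves both for filling the next cell (`t' = t + 1`) and for overwriting a cell of a full table
whose relation changes only there. -/
theorem HasTable.update {n ℓ t v i a j b : ℕ} {Q Q' : ℕ → ℕ → ℕ → ℕ → Prop} {mem : ℕ → ℕ}
    (h : HasTable n ℓ t Q mem) (ha : a < 4) (hj : j < n) (hb : b < 4)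
    (hv : Q' i a j b ∧ v = 1 ∨ ¬ Q' i a j b ∧ v = 0) {t' : ℕ}
    (ht : ∀ w, w ≠ idx n i a j b → w < t' → w < t)
    (hQ : ∀ i' a' j' b', idx n i' a' j' b' ≠ idx n i a j b → (Q i' a' j' b' ↔ Q' i' a' j' b')) :
    HasTable n ℓ t' Q' (Function.update mem (n * ℓ + idx n i a j b) v) := by
  intro i' hi' a' ha' j' hj' b' hb' hlt
  by_cases e : idx n i' a' j' b' = idx n i a j b
  · obtain ⟨rfl, rfl, rfl, rfl⟩ := idx_inj ha' hj' hb' ha hj hb e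
    rw [Function.update_self]
    rcases hv with ⟨h1, rfl⟩ | ⟨h1, rfl⟩ <;> simp [h1]
  · rw [Function.update_of_ne (by omega), h i' hi' a' ha' j' hj' b' hb' (ht _ e hlt)]
    rw [propext (hQ i' a' j' b' e)]

/-- The registers hold the parameters of the instance. -/
structure Params (n ℓ α : ℕ) (s : State) : Prop where
  r0 : s.reg 0 = n
  r1 : s.reg 1 = ℓ
  r2 : s.reg 2 = α
  r4 : s.reg 4 = 4
  r5 : s.reg 5 = n * ℓ
  r6 : s.reg 6 = 4 * n

theorem Params.of_reg_eq {n ℓ α : ℕ} {s s' : State} (h : Params n ℓ α s)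
    (hf : ∀ z ∈ [0, 1, 2, 4, 5, 6], s'.reg z = s.reg z) : Params n ℓ α s' :=
  ⟨(hf 0 (by simp)).trans h.r0, (hf 1 (by simp)).trans h.r1, (hf 2 (by simp)).trans h.r2,
    (hf 4 (by simp)).trans h.r4, (hf 5 (by simp)).trans h.r5, (hf 6 (by simp)).trans h.r6⟩

/-- The address of the pair of completed rows in the registers `8`, `9` and `10`, `11`. -/
def pairAddr : Expr :=
  .add (.reg 5) (.add (.mul (.add (.mul (.reg 4) (.reg 8)) (.reg 9)) (.reg 6))
    (.add (.mul (.reg 4) (.reg 10)) (.reg 11)))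

section

variable {B n ℓ α i a j b : ℕ} {s : State}

theorem eval_pairAddr (hP : Params n ℓ α s) (h8 : s.reg 8 = i) (h9 : s.reg 9 = a)
    (h10 : s.reg 10 = j) (h11 : s.reg 11 = b) :
    pairAddr.eval s = n * ℓ + idx n i a j b := by
  simp [pairAddr, Expr.eval, hP.r5, hP.r4, hP.r6, h8, h9, h10, h11, idx]

theorem fits_pairAddr (hP : Params n ℓ α s) (h8 : s.reg 8 = i) (h9 : s.reg 9 = a)
    (h10 : s.reg 10 = j) (h11 : s.reg 11 = b) (hi : i < n) (ha : a < 4) (hj : j < n) (hb : b < 4)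
    (hB : n * ℓ + 16 * n * n + 4 * n + 8 ≤ B) : pairAddr.Fits B s := by
  have := idx_lt hi ha hj hb
  simp only [pairAddr, Expr.Fits, Expr.eval, hP.r5, hP.r4, hP.r6, h8, h9, h10, h11]
  unfold idx at this
  omega

end

/-- The initial entry of the table for a pair of completed rows. -/
def initBody : Prog :=
  .seq (.assign 20 (.mul (.reg 8) (.reg 1))) (.seq (.assign 21 (.reg 9))
    (.seq (.assign 22 (.mul (.reg 10) (.reg 1))) (.seq (.assign 23 (.reg 11))
      (.seq distProg (.store pairAddr (.sub (.lit 1)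
        (.mul (.add (.sub (.reg 8) (.reg 10)) (.sub (.reg 10) (.reg 8)))
          (.add (.sub (.reg 29) (.reg 2)) (.sub (.reg 2) (.reg 29))))))))))

/-- The word size suffices for the computation. -/
def Large (B n ℓ α : ℕ) : Prop :=
  n * ℓ + 16 * n * n + n * (ℓ + α) + 4 * n + ℓ + α + 8 ≤ B

theorem hammingDist_fillRow_le {n ℓ : ℕ} (S : PartialMatrix n ℓ) (i a j b : ℕ) :
    hammingDist (fillRow S i a) (fillRow S j b) ≤ ℓ :=
  hammingDist_le_card_fintype.trans (by simp)

/-- The stored value `1 - |i - j| * |d - α|`, truncated, is 1 exactly if the rows are the same or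
have distance `α`. -/
theorem runs_initBody {B n ℓ α i a j b : ℕ} {S : PartialMatrix n ℓ} {s : State} {g : Fin ℓ → Bool}
    (hB : Large B n ℓ α) (hi : i < n) (hj : j < n) (ha : a < 4) (hb : b < 4)
    (hP : Params n ℓ α s) (hS : HasMatrix S s.mem)
    (h8 : s.reg 8 = i) (h9 : s.reg 9 = a) (h10 : s.reg 10 = j) (h11 : s.reg 11 = b)
    (hT : HasTable n ℓ (idx n i a j b) (fun i a j b => Rel hammingDist α (n - 1) (fillRow S) g 0
      i (fillRow S i a) j (fillRow S j b)) s.mem) :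
    Runs B initBody s (ℓ * 78 + 60) fun s' => HasMatrix S s'.mem ∧
      HasTable n ℓ (idx n i a j b + 1) (fun i a j b => Rel hammingDist α (n - 1) (fillRow S) g 0
        i (fillRow S i a) j (fillRow S j b)) s'.mem := by
  unfold Large at hB
  have hil : i * ℓ ≤ n * ℓ := Nat.mul_le_mul_right _ hi.le
  have hjl : j * ℓ ≤ n * ℓ := Nat.mul_le_mul_right _ hj.le
  refine Runs.assign_seq (ℓ * 78 + 56) ?_ (by simp [Expr.cost]; omega) ?_
  · simp only [Expr.Fits, Expr.eval, h8, hP.r1]; omega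
  refine Runs.assign_seq (ℓ * 78 + 54) ?_ (by simp [Expr.cost]; omega) ?_
  · simp [Expr.Fits, h9]; omega
  refine Runs.assign_seq (ℓ * 78 + 50) ?_ (by simp [Expr.cost]; omega) ?_
  · simp [Expr.Fits, Expr.eval, h10, hP.r1]; omega
  refine Runs.assign_seq (ℓ * 78 + 48) ?_ (by simp [Expr.cost]; omega) ?_
  · simp [Expr.Fits, h11]; omega
  refine Runs.seq (ℓ * 78 + 8) 40 (by omega) (Runs.mono (runs_distProg (S := S) (i := i)
    (a := a) (j := j) (b := b) (by omega) hi hj ha hb hS (by simp [hP.r1]) (by simp [Expr.eval, h8, hP.r1])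
    (by simp [Expr.eval, h9]) (by simp [Expr.eval, h10, hP.r1])
    (by simp [Expr.eval, h11])) le_rfl ?_)
  rintro s₁ hf ⟨hm, hd⟩
  have hP₁ : Params n ℓ α s₁ := by
    refine hP.of_reg_eq fun z hz => ?_
    simp only [List.mem_cons, List.not_mem_nil, or_false] at hz
    rcases hz with rfl | rfl | rfl | rfl | rfl | rfl <;> rw [hf _ (by decide)] <;> simp
  have e8 : s₁.reg 8 = i := by rw [hf _ (by decide)]; simpa using h8
  have e9 : s₁.reg 9 = a := by rw [hf _ (by decide)]; simpa using h9
  have e10 : s₁.reg 10 = j := by rw [hf _ (by decide)]; simpa using h10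
  have e11 : s₁.reg 11 = b := by rw [hf _ (by decide)]; simpa using h11
  have hdl := hammingDist_fillRow_le S i a j b
  simp only at hm
  refine Runs.store ?_ ?_ (by simp [Expr.cost, pairAddr]) ?_
  · exact fits_pairAddr hP₁ e8 e9 e10 e11 hi ha hj hb (by omega)
  · simp only [Expr.Fits, Expr.eval, e8, e10, hd, hP₁.r2]
    -- This product is the reason for the summand `n * (ℓ + α)` in `Large`.
    have : (i - j + (j - i)) * (hammingDist (fillRow S i a) (fillRow S j b) - α
        + (α - hammingDist (fillRow S i a) (fillRow S j b))) ≤ n * (ℓ + α) :=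
      Nat.mul_le_mul (by omega) (by omega)
    omega
  · rw [eval_pairAddr hP₁ e8 e9 e10 e11]
    simp only [Expr.eval, e8, e10, hd, hP₁.r2, hm]
    refine ⟨hS.update, hT.update ha hj hb ?_ (by omega) fun _ _ _ _ _ => Iff.rfl⟩
    simp only [Rel]
    by_cases h : i = j ∨ hammingDist (fillRow S i a) (fillRow S j b) = α
    · left
      refine ⟨h, ?_⟩
      have : (i - j + (j - i)) * (hammingDist (fillRow S i a) (fillRow S j b) - α
        + (α - hammingDist (fillRow S i a) (fillRow S j b))) = 0 := by
        rw [Nat.mul_eq_zero]; omega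
      omega
    · right
      refine ⟨h, ?_⟩
      have : (i - j + (j - i)) * (hammingDist (fillRow S i a) (fillRow S j b) - α
        + (α - hammingDist (fillRow S i a) (fillRow S j b))) ≠ 0 := by
        rw [Nat.mul_ne_zero_iff]; omega
      omega

/-- The entry of the table for the completed row whose part of the table starts in the register
`30` and the completed row in the registers `x` and `y`. -/
def entryExpr (x y : ℕ) : Expr :=
  .mem (.add (.reg 30) (.add (.mul (.reg 4) (.reg x)) (.reg y)))

/-- The number of the last row. -/
def lastRow : Expr := .sub (.reg 0) (.lit 1)

/-- The entry of the table for the completed row whose part of the table starts in the register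
`30` and the choice for the last row in the register `7`. -/
def lastExpr : Expr :=
  .mem (.add (.reg 30) (.add (.mul (.reg 4) lastRow) (.reg 7)))

/-- The elimination of the row in the register `12`, for a pair of completed rows. -/
def elimBody : Prog :=
  .ite (.mul (.sub (.reg 8) (.reg 12)) (.sub (.reg 10) (.reg 12)))
    (.seq (.assign 31 (.lit 0))
      (.seq (forLoop 14 4 (.seq
        (.assign 30 (.add (.reg 5) (.mul (.add (.mul (.reg 4) (.reg 12)) (.reg 14)) (.reg 6))))
        (.assign 31 (.add (.reg 31) (.mul (.mul (entryExpr 12 14) (entryExpr 8 9))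
          (.mul (entryExpr 10 11) lastExpr))))))
        (.ite (.reg 31) .skip (.store pairAddr (.lit 0)))))
    .skip

open Classical in
theorem eval_entryExpr {B n ℓ α k c x y i a : ℕ} {Q : ℕ → ℕ → ℕ → ℕ → Prop} {s : State}
    (hP : Params n ℓ α s) (hT : HasTable n ℓ (16 * n * n) Q s.mem)
    (hB : n * ℓ + 16 * n * n + 4 * n + 8 ≤ B) (hk : k < n)
    (hc : c < 4) (hi : i < n) (ha : a < 4) (h30 : s.reg 30 = n * ℓ + (4 * k + c) * (4 * n))
    (hx : s.reg x = i) (hy : s.reg y = a) :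
    (entryExpr x y).Fits B s ∧ (entryExpr x y).eval s = if Q k c i a then 1 else 0 := by
  have h1 := idx_lt hk hc hi ha
  have h2 := hT k hk c hc i hi a ha h1
  have h3 : n * ℓ + (4 * k + c) * (4 * n) + (4 * i + a) = n * ℓ + idx n k c i a := by
    rw [idx]; ring
  simp only [entryExpr, Expr.Fits, Expr.eval, h30, hP.r4, hx, hy, h3, h2]
  unfold idx at h1
  split <;> simp <;> omega

open Classical in
theorem eval_lastExpr {B n ℓ α k c a : ℕ} {Q : ℕ → ℕ → ℕ → ℕ → Prop} {s : State}
    (hP : Params n ℓ α s) (hT : HasTable n ℓ (16 * n * n) Q s.mem)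
    (hB : n * ℓ + 16 * n * n + 4 * n + 8 ≤ B) (hk : k < n)
    (hc : c < 4) (ha : a < 4) (h30 : s.reg 30 = n * ℓ + (4 * k + c) * (4 * n))
    (h7 : s.reg 7 = a) :
    lastExpr.Fits B s ∧ lastExpr.eval s = if Q k c (n - 1) a then 1 else 0 := by
  have h1 := idx_lt hk hc (j := n - 1) (by omega) ha
  have h2 := hT k hk c hc (n - 1) (by omega) a ha h1
  have h3 : n * ℓ + (4 * k + c) * (4 * n) + (4 * (n - 1) + a) = n * ℓ + idx n k c (n - 1) a := by
    rw [idx]; ring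
  simp only [lastExpr, lastRow, Expr.Fits, Expr.eval, h30, hP.r4, hP.r0, h7, h3, h2]
  unfold idx at h1
  split <;> simp <;> omega

/-- The constraints during the elimination of the row `k`. -/
def ElimRel {n ℓ : ℕ} (S : PartialMatrix n ℓ) (α g k t i a j b : ℕ) : Prop :=
  Rel hammingDist α (n - 1) (fillRow S) (fillRow S (n - 1) g) k i (fillRow S i a) j (fillRow S j b)
    ∧ (idx n i a j b < t → k < i → k < j → ∃ c < 4,
      Rel hammingDist α (n - 1) (fillRow S) (fillRow S (n - 1) g) k
        k (fillRow S k c) k (fillRow S k c) ∧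
      Rel hammingDist α (n - 1) (fillRow S) (fillRow S (n - 1) g) k
        k (fillRow S k c) i (fillRow S i a) ∧
      Rel hammingDist α (n - 1) (fillRow S) (fillRow S (n - 1) g) k
        k (fillRow S k c) j (fillRow S j b) ∧
      Rel hammingDist α (n - 1) (fillRow S) (fillRow S (n - 1) g) k
        k (fillRow S k c) (n - 1) (fillRow S (n - 1) g))

/-- The elimination works in place: round `k` alters only pairs of rows after `k` and reads only
entries whose first row is `k`. -/
theorem elimRel_row {n ℓ : ℕ} (S : PartialMatrix n ℓ) (α g k t c j b : ℕ) :
    ElimRel S α g k t k c j b ↔ Rel hammingDist α (n - 1) (fillRow S) (fillRow S (n - 1) g) k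
      k (fillRow S k c) j (fillRow S j b) := by
  simp [ElimRel]

theorem elimRel_succ_of_ne {n ℓ : ℕ} (S : PartialMatrix n ℓ) {α g k t i a j b : ℕ}
    (h : idx n i a j b ≠ t) : ElimRel S α g k t i a j b ↔ ElimRel S α g k (t + 1) i a j b := by
  have : idx n i a j b < t + 1 ↔ idx n i a j b < t := by omega
  simp [ElimRel, this]

theorem HasTable.congr {n ℓ t : ℕ} {Q Q' : ℕ → ℕ → ℕ → ℕ → Prop} {mem : ℕ → ℕ}
    (h : HasTable n ℓ t Q mem)
    (hQ : ∀ i < n, ∀ a < 4, ∀ j < n, ∀ b < 4, (Q i a j b ↔ Q' i a j b)) :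
    HasTable n ℓ t Q' mem := by
  intro i hi a ha j hj b hb hlt
  rw [h i hi a ha j hj b hb hlt]
  rw [propext (hQ i hi a ha j hj b hb)]

/-- Register `31` counts the values of row `k` for which all four table entries are 1. If there are
none, 0 is correct whatever the old entry was; otherwise the old entry stays. -/
theorem runs_elimBody {B n ℓ α g k i a j b : ℕ} {S : PartialMatrix n ℓ} {s : State}
    (hB : Large B n ℓ α) (hg : g < 4) (hk : k < n) (hi : i < n) (hj : j < n) (ha : a < 4)
    (hb : b < 4) (hP : Params n ℓ α s) (hS : HasMatrix S s.mem) (h7 : s.reg 7 = g)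
    (h12 : s.reg 12 = k) (h8 : s.reg 8 = i) (h9 : s.reg 9 = a) (h10 : s.reg 10 = j)
    (h11 : s.reg 11 = b)
    (hT : HasTable n ℓ (16 * n * n) (ElimRel S α g k (idx n i a j b)) s.mem) :
    Runs B elimBody s 400 fun s' => HasMatrix S s'.mem ∧
      HasTable n ℓ (16 * n * n) (ElimRel S α g k (idx n i a j b + 1)) s'.mem := by
  unfold Large at hB
  have h16 : n * n ≤ 16 * n * n := by rw [mul_assoc]; omega
  refine Runs.ite 380 ?_ (by simp [Expr.cost]) ?_ ?_
  · simp only [Expr.Fits, Expr.eval, h8, h10, h12]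
    have : (i - k) * (j - k) ≤ n * n := Nat.mul_le_mul (by omega) (by omega)
    omega
  · intro hne
    simp only [Expr.eval, h8, h10, h12, Nat.mul_ne_zero_iff] at hne
    have hki : k < i := by omega
    have hkj : k < j := by omega
    refine Runs.assign_seq 370 (by simp [Expr.Fits]) (by simp [Expr.cost]) ?_
    refine Runs.seq 320 40 (by omega) ((runs_forLoop (N := 4) (T := 60) (fun c s' =>
      s'.mem = s.mem ∧ s'.reg 31 ≤ c ∧ (s'.reg 31 ≠ 0 ↔ ∃ c' < c,
        ElimRel S α g k (idx n i a j b) k c' k c' ∧ ElimRel S α g k (idx n i a j b) k c' i a ∧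
        ElimRel S α g k (idx n i a j b) k c' j b ∧
        ElimRel S α g k (idx n i a j b) k c' (n - 1) g)) (by decide) (by decide) (by decide)
      (by simp [hP.r4]) (by omega) (by simp [Expr.eval]) ?_).mono (by omega) ?_)
    · rintro c hc s₁ ⟨hm, hle, hiff⟩ h14 hf
      have hP₁ : Params n ℓ α s₁ := by
        refine hP.of_reg_eq fun z hz => ?_
        simp only [List.mem_cons, List.not_mem_nil, or_false] at hz
        rcases hz with rfl | rfl | rfl | rfl | rfl | rfl <;> rw [hf _ (by decide)] <;> simp
      have e7 : s₁.reg 7 = g := by rw [hf _ (by decide)]; simpa using h7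
      have e8 : s₁.reg 8 = i := by rw [hf _ (by decide)]; simpa using h8
      have e9 : s₁.reg 9 = a := by rw [hf _ (by decide)]; simpa using h9
      have e10 : s₁.reg 10 = j := by rw [hf _ (by decide)]; simpa using h10
      have e11 : s₁.reg 11 = b := by rw [hf _ (by decide)]; simpa using h11
      have e12 : s₁.reg 12 = k := by rw [hf _ (by decide)]; simpa using h12
      refine Runs.assign_seq 48 ?_ (by simp [Expr.cost]) ?_
      · have := idx_lt hk hc hk hc
        unfold idx at this
        simp only [Expr.Fits, Expr.eval, hP₁.r5, hP₁.r4, hP₁.r6, e12, h14]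
        omega
      · set s₂ : State := ⟨Function.update s₁.reg 30 (Expr.eval s₁ (.add (.reg 5)
          (.mul (.add (.mul (.reg 4) (.reg 12)) (.reg 14)) (.reg 6)))), s₁.mem⟩ with hs₂
        have hP₂ : Params n ℓ α s₂ := hP₁.of_reg_eq fun z hz => by
          simp only [List.mem_cons, List.not_mem_nil, or_false] at hz
          rcases hz with rfl | rfl | rfl | rfl | rfl | rfl <;> simp [hs₂]
        have hT₂ : HasTable n ℓ (16 * n * n) (ElimRel S α g k (idx n i a j b)) s₂.mem := by
          simpa [hs₂, hm] using hT
        have e30 : s₂.reg 30 = n * ℓ + (4 * k + c) * (4 * n) := by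
          simp [hs₂, Expr.eval, hP₁.r5, hP₁.r4, hP₁.r6, e12, h14]
        have hB' : n * ℓ + 16 * n * n + 4 * n + 8 ≤ B := by omega
        obtain ⟨f1, v1⟩ := eval_entryExpr hP₂ hT₂ hB' hk hc hk hc e30
          (x := 12) (y := 14) (by simp [hs₂, e12]) (by simp [hs₂, h14])
        obtain ⟨f2, v2⟩ := eval_entryExpr hP₂ hT₂ hB' hk hc hi ha e30
          (x := 8) (y := 9) (by simp [hs₂, e8]) (by simp [hs₂, e9])
        obtain ⟨f3, v3⟩ := eval_entryExpr hP₂ hT₂ hB' hk hc hj hb e30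
          (x := 10) (y := 11) (by simp [hs₂, e10]) (by simp [hs₂, e11])
        obtain ⟨f4, v4⟩ := eval_lastExpr hP₂ hT₂ hB' hk hc hg e30 (by simp [hs₂, e7])
        have e31 : s₂.reg 31 = s₁.reg 31 := by simp [hs₂]
        refine Runs.assign ?_ (by simp [Expr.cost, entryExpr, lastExpr, lastRow]) ?_
        · simp only [Expr.Fits, Expr.eval, f1, f2, f3, f4, v1, v2, v3, v4, e31, true_and]
          split <;> split <;> split <;> split <;> simp <;> omega
        · simp only [Expr.eval, v1, v2, v3, v4, e31, Nat.lt_succ_iff_lt_or_eq, or_and_right,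
            exists_or, exists_eq_left, ← hiff]
          by_cases q1 : ElimRel S α g k (idx n i a j b) k c k c <;>
          by_cases q2 : ElimRel S α g k (idx n i a j b) k c i a <;>
          by_cases q3 : ElimRel S α g k (idx n i a j b) k c j b <;>
          by_cases q4 : ElimRel S α g k (idx n i a j b) k c (n - 1) g <;>
          simp [q1, q2, q3, q4, hs₂, hm] <;> omega
    · rintro s₁ hf ⟨hm, hle, hiff⟩
      have hP₁ : Params n ℓ α s₁ := by
        refine hP.of_reg_eq fun z hz => ?_
        simp only [List.mem_cons, List.not_mem_nil, or_false] at hz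
        rcases hz with rfl | rfl | rfl | rfl | rfl | rfl <;> rw [hf _ (by decide)] <;> simp
      have e8 : s₁.reg 8 = i := by rw [hf _ (by decide)]; simpa using h8
      have e9 : s₁.reg 9 = a := by rw [hf _ (by decide)]; simpa using h9
      have e10 : s₁.reg 10 = j := by rw [hf _ (by decide)]; simpa using h10
      have e11 : s₁.reg 11 = b := by rw [hf _ (by decide)]; simpa using h11
      simp only [elimRel_row] at hiff
      refine Runs.ite 30 (by simp only [Expr.Fits]; omega) (by simp [Expr.cost]) ?_ ?_
      · intro h
        refine Runs.skip (by simp) ?_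
        rw [hm]
        refine ⟨hS, hT.congr fun i' _ a' ha' j' hj' b' hb' => ?_⟩
        by_cases e : idx n i' a' j' b' = idx n i a j b
        · obtain ⟨rfl, rfl, rfl, rfl⟩ := idx_inj ha' hj' hb' ha hj hb e
          simp only [Expr.eval] at h
          simp only [ElimRel, lt_irrefl, false_imp_iff, and_true, Nat.lt_succ_self, true_imp_iff]
          exact ⟨fun h' => ⟨h', fun _ _ => hiff.1 h⟩, fun h' => h'.1⟩
        · exact elimRel_succ_of_ne S e
      · intro h
        refine Runs.store ?_ (by simp [Expr.Fits]) (by simp [Expr.cost, pairAddr]) ?_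
        · exact fits_pairAddr hP₁ e8 e9 e10 e11 hi ha hj hb (by omega)
        · rw [eval_pairAddr hP₁ e8 e9 e10 e11, hm]
          refine ⟨hS.update, hT.update ha hj hb (Or.inr ⟨?_, rfl⟩) (fun _ _ h => h)
            fun _ _ _ _ e => elimRel_succ_of_ne S e⟩
          rintro ⟨-, h'⟩
          exact hiff.2 (h' (Nat.lt_succ_self _) hki hkj) h
  · intro h0
    simp only [Expr.eval, h8, h10, h12, Nat.mul_eq_zero] at h0
    refine Runs.skip (by simp) ⟨hS, hT.congr fun i' _ a' ha' j' hj' b' hb' => ?_⟩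
    by_cases e : idx n i' a' j' b' = idx n i a j b
    · obtain ⟨rfl, rfl, rfl, rfl⟩ := idx_inj ha' hj' hb' ha hj hb e
      have : k < i' → k < j' → False := by omega
      simp only [ElimRel, lt_irrefl, false_imp_iff, and_true, Nat.lt_succ_self, true_imp_iff]
      exact ⟨fun h' => ⟨h', fun h1 h2 => (this h1 h2).elim⟩, fun h' => h'.1⟩
    · exact elimRel_succ_of_ne S e

end DMC

namespace DMC

open RAM

/-! ### The search for the choice for the last row -/

/-- The elimination of all rows. -/
def elimProg : Prog := forLoop 12 0 (forPairs elimBody)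

theorem runs_elimProg {B n ℓ α g : ℕ} {S : PartialMatrix n ℓ} {s : State}
    (hB : Large B n ℓ α) (hg : g < 4) (hn : 0 < n) (hP : Params n ℓ α s) (hS : HasMatrix S s.mem)
    (h7 : s.reg 7 = g)
    (hT : HasTable n ℓ (16 * n * n) (fun i a j b => Rel hammingDist α (n - 1) (fillRow S)
      (fillRow S (n - 1) g) 0 i (fillRow S i a) j (fillRow S j b)) s.mem) :
    Runs B elimProg s (n * (n ^ 2 * 6660 + 8) + 6) fun s' => HasMatrix S s'.mem ∧
      HasTable n ℓ (16 * n * n) (fun i a j b => Rel hammingDist α (n - 1) (fillRow S)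
        (fillRow S (n - 1) g) n i (fillRow S i a) j (fillRow S j b)) s'.mem := by
  have hB' := hB
  unfold Large at hB'
  refine runs_forLoop (N := n) (T := n ^ 2 * 6660) (fun k s' => HasMatrix S s'.mem ∧
      HasTable n ℓ (16 * n * n) (fun i a j b => Rel hammingDist α (n - 1) (fillRow S)
        (fillRow S (n - 1) g) k i (fillRow S i a) j (fillRow S j b)) s'.mem)
    (by decide) (by decide) (by decide) hP.r0 (by omega) ⟨hS, hT⟩ ?_
  rintro k hk s₁ ⟨hS₁, hT₁⟩ h12 hf
  have hP₁ : Params n ℓ α s₁ := by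
    refine hP.of_reg_eq fun z hz => ?_
    simp only [List.mem_cons, List.not_mem_nil, or_false] at hz
    rcases hz with rfl | rfl | rfl | rfl | rfl | rfl <;> exact hf _ (by decide)
  have e7 : s₁.reg 7 = g := by rw [hf _ (by decide), h7]
  refine (runs_forPairs (n := n) (T := 400) (fun t mem => HasMatrix S mem ∧
    HasTable n ℓ (16 * n * n) (ElimRel S α g k t) mem) (by decide) (by omega) hn hP₁.r0 hP₁.r4
    ⟨hS₁, hT₁.congr fun i _ a _ j _ b _ => by simp [ElimRel]⟩ ?_).mono (by simp) ?_
  · rintro i hi a ha j hj b hb s₂ ⟨hS₂, hT₂⟩ h8 h9 h10 h11 hf₂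
    have hP₂ : Params n ℓ α s₂ := by
      refine hP₁.of_reg_eq fun z hz => ?_
      simp only [List.mem_cons, List.not_mem_nil, or_false] at hz
      rcases hz with rfl | rfl | rfl | rfl | rfl | rfl <;> exact hf₂ _ (by decide)
    exact runs_elimBody hB hg hk hi hj ha hb hP₂ hS₂ (by rw [hf₂ _ (by decide), e7])
      (by rw [hf₂ _ (by decide), h12]) h8 h9 h10 h11 hT₂
  · rintro s₂ - ⟨hS₂, hT₂⟩
    refine ⟨hS₂, hT₂.congr fun i hi a ha j hj b hb => ?_⟩
    simp only [ElimRel, Rel, idx_lt hi ha hj hb, true_imp_iff]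

/-- The test whether there is a solution with the choice in the register `7` for the last row. -/
def guessBody : Prog :=
  .seq (forPairs initBody) (.seq elimProg (.assign 13 (.add (.reg 13) (.mem (.add (.reg 5) (.add
    (.mul (.add (.mul (.reg 4) lastRow) (.reg 7)) (.reg 6))
    (.add (.mul (.reg 4) lastRow) (.reg 7))))))))

/-- The search for a solution. -/
def searchProg : Prog := .seq (.assign 13 (.lit 0)) (forLoop 7 4 guessBody)

/-- Elimination destroys the table, so it is rebuilt for each guess. Register `13` counts the
successful guesses. -/
theorem runs_searchProg {B n ℓ α : ℕ} {S : PartialMatrix n ℓ} {s : State}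
    (hmax : maxMissing S ≤ 2) (hB : Large B n ℓ α) (hn : 0 < n) (hP : Params n ℓ α s)
    (hS : HasMatrix S s.mem) :
    Runs B searchProg s (4 * ((n ^ 2 * (16 * (ℓ * 78 + 60) + 260)
      + (n * (n ^ 2 * 6660 + 8) + 6) + 40) + 8) + 8)
      fun s' => s'.reg 13 ≤ 4 ∧ (s'.reg 13 ≠ 0 ↔ IsYes S α α) := by
  rw [isYes_iff_rel hmax hn]
  have hB' := hB
  unfold Large at hB'
  refine Runs.assign_seq (4 * ((n ^ 2 * (16 * (ℓ * 78 + 60) + 260)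
      + (n * (n ^ 2 * 6660 + 8) + 6) + 40) + 8) + 6) (by simp [Expr.Fits])
      (by simp [Expr.cost]; omega) ?_
  refine (runs_forLoop (N := 4) (T := n ^ 2 * (16 * (ℓ * 78 + 60) + 260)
      + (n * (n ^ 2 * 6660 + 8) + 6) + 40) (fun g s' => HasMatrix S s'.mem ∧ s'.reg 13 ≤ g ∧
      (s'.reg 13 ≠ 0 ↔ ∃ a < g, Rel hammingDist α (n - 1) (fillRow S) (fillRow S (n - 1) a) n
        (n - 1) (fillRow S (n - 1) a) (n - 1) (fillRow S (n - 1) a))) (by decide) (by decide)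
    (by decide) (by simp [hP.r4]) (by omega) (by simp [Expr.eval, hS]) ?_).mono le_rfl
    fun s' _ h => h.2
  rintro g hg s₁ ⟨hS₁, hle, hiff⟩ h7 hf
  have hP₁ : Params n ℓ α s₁ := by
    refine hP.of_reg_eq fun z hz => ?_
    simp only [List.mem_cons, List.not_mem_nil, or_false] at hz
    rcases hz with rfl | rfl | rfl | rfl | rfl | rfl <;> rw [hf _ (by decide)] <;> simp
  refine Runs.seq (n ^ 2 * (16 * (ℓ * 78 + 60) + 260)) (n * (n ^ 2 * 6660 + 8) + 6 + 40)
    (by omega) (Runs.mono (runs_forPairs (n := n) (T := ℓ * 78 + 60)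
    (fun t mem => HasMatrix S mem ∧ HasTable n ℓ t (fun i a j b => Rel hammingDist α (n - 1)
      (fillRow S) (fillRow S (n - 1) g) 0 i (fillRow S i a) j (fillRow S j b)) mem) (by decide)
    -- Before place 0 nothing is claimed, so remnants of the previous table do no harm.
    (by omega) hn hP₁.r0 hP₁.r4 ⟨hS₁, fun _ _ _ _ _ _ _ _ h => absurd h (Nat.not_lt_zero _)⟩ ?_)
    le_rfl ?_)
  · rintro i hi a ha j hj b hb s₂ ⟨hS₂, hT₂⟩ h8 h9 h10 h11 hf₂
    have hP₂ : Params n ℓ α s₂ := by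
      refine hP₁.of_reg_eq fun z hz => ?_
      simp only [List.mem_cons, List.not_mem_nil, or_false] at hz
      rcases hz with rfl | rfl | rfl | rfl | rfl | rfl <;> exact hf₂ _ (by decide)
    exact runs_initBody hB hi hj ha hb hP₂ hS₂ h8 h9 h10 h11 hT₂
  · rintro s₂ hf₂ ⟨hS₂, hT₂⟩
    have hP₂ : Params n ℓ α s₂ := by
      refine hP₁.of_reg_eq fun z hz => ?_
      simp only [List.mem_cons, List.not_mem_nil, or_false] at hz
      rcases hz with rfl | rfl | rfl | rfl | rfl | rfl <;> exact hf₂ _ (by decide)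
    refine Runs.seq (n * (n ^ 2 * 6660 + 8) + 6) 40 le_rfl (Runs.mono (runs_elimProg hB hg hn hP₂
      hS₂ (by rw [hf₂ _ (by decide), h7]) hT₂) le_rfl ?_)
    rintro s₃ hf₃ ⟨hS₃, hT₃⟩
    have hP₃ : Params n ℓ α s₃ := by
      refine hP₂.of_reg_eq fun z hz => ?_
      simp only [List.mem_cons, List.not_mem_nil, or_false] at hz
      rcases hz with rfl | rfl | rfl | rfl | rfl | rfl <;> exact hf₃ _ (by decide)
    have e7 : s₃.reg 7 = g := by rw [hf₃ _ (by decide), hf₂ _ (by decide), h7]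
    have e13 : s₃.reg 13 = s₁.reg 13 := by rw [hf₃ _ (by decide), hf₂ _ (by decide)]
    have hlt := idx_lt (n := n) (i := n - 1) (j := n - 1) (by omega) hg (by omega) hg
    have hv := hT₃ (n - 1) (by omega) g hg (n - 1) (by omega) g hg hlt
    unfold idx at hv hlt
    refine Runs.assign ?_ (by simp [Expr.cost, lastRow]) ?_
    · simp only [Expr.Fits, Expr.eval, lastRow, hP₃.r0, hP₃.r4, hP₃.r5, hP₃.r6, e7, e13, hv]
      split <;> omega
    · refine ⟨hS₃, ?_⟩
      simp only [Expr.eval, lastRow, hP₃.r0, hP₃.r4, hP₃.r5, hP₃.r6, e7, e13, hv,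
        Nat.lt_succ_iff_lt_or_eq, or_and_right, exists_or, exists_eq_left, ← hiff]
      by_cases q : Rel hammingDist α (n - 1) (fillRow S) (fillRow S (n - 1) g) n
        (n - 1) (fillRow S (n - 1) g) (n - 1) (fillRow S (n - 1) g) <;> simp [q] <;> omega

/-! ### Instances in which all rows have to be equal -/

/-- The test whether all rows have a common completion. -/
def compatProg : Prog :=
  .seq (.assign 13 (.lit 1)) (forLoop 10 1 (forLoop 8 0 (forLoop 11 0
    (.ite (.mul (.sub (.lit 1) (.mem (.add (.mul (.reg 8) (.reg 1)) (.reg 10))))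
      (.mul (.mem (.add (.mul (.reg 11) (.reg 1)) (.reg 10)))
        (.sub (.lit 2) (.mem (.add (.mul (.reg 11) (.reg 1)) (.reg 10))))))
      (.assign 13 (.lit 0)) .skip))))

/-- For entries `x` and `y` of a column, `(1 - x) * (y * (2 - y))` is nonzero exactly if `x = 0` and
`y = 1`. The invariant of each inner loop is relative to the flag at its start. -/
theorem runs_compatProg {B n ℓ : ℕ} {S : PartialMatrix n ℓ} {s : State}
    (hB : Large B n ℓ 0) (h0 : s.reg 0 = n) (h1 : s.reg 1 = ℓ) (hS : HasMatrix S s.mem) :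
    Runs B compatProg s (ℓ * ((n * ((n * (40 + 8) + 6) + 8) + 6) + 8) + 8)
      fun s' => s'.reg 13 ≤ 1 ∧ (s'.reg 13 = 1 ↔ IsYes S 0 0) := by
  rw [isYes_zero_iff]
  unfold Large at hB
  refine Runs.assign_seq (ℓ * ((n * ((n * (40 + 8) + 6) + 8) + 6) + 8) + 6)
    (by simp [Expr.Fits]; omega) (by simp [Expr.cost]; omega) ?_
  have hor : ∀ {m : ℕ} {p : ℕ → Prop}, (∀ x < m + 1, p x) ↔ (∀ x < m, p x) ∧ p m := by
    intro m p
    simp only [Nat.lt_succ_iff_lt_or_eq]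
    exact ⟨fun h => ⟨fun x hx => h x (Or.inl hx), h m (Or.inr rfl)⟩,
      fun h x hx => hx.elim (h.1 x) fun e => e ▸ h.2⟩
  refine (runs_forLoop (N := ℓ) (T := n * ((n * (40 + 8) + 6) + 8) + 6) (fun j s' =>
    s'.mem = s.mem ∧ s'.reg 13 ≤ 1 ∧ (s'.reg 13 = 1 ↔ ∀ j' < j, ∀ i < n, ∀ i' < n,
      ¬ (code S i j' = 0 ∧ code S i' j' = 1))) (by decide) (by decide) (by decide) (by simp [h1])
    (by omega) (by simp [Expr.eval]) ?_).mono le_rfl fun s' _ h => h.2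
  rintro j hj s₁ ⟨hm₁, hle₁, hi₁⟩ h10 hf₁
  have a0 : s₁.reg 0 = n := by rw [hf₁ _ (by decide)]; simpa using h0
  have a1 : s₁.reg 1 = ℓ := by rw [hf₁ _ (by decide)]; simpa using h1
  rw [hor, ← hi₁]
  refine (runs_forLoop (N := n) (T := n * (40 + 8) + 6) (fun i s' =>
    s'.mem = s.mem ∧ s'.reg 13 ≤ 1 ∧ (s'.reg 13 = 1 ↔ s₁.reg 13 = 1 ∧ ∀ i₁ < i, ∀ i' < n,
      ¬ (code S i₁ j = 0 ∧ code S i' j = 1))) (by decide) (by decide) (by decide) a0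
    (by omega) (by simp [hm₁, hle₁]) ?_).mono le_rfl fun s' _ h => by simpa using h
  rintro i hi s₂ ⟨hm₂, hle₂, hi₂⟩ h8 hf₂
  have b0 : s₂.reg 0 = n := by rw [hf₂ _ (by decide), a0]
  have b1 : s₂.reg 1 = ℓ := by rw [hf₂ _ (by decide), a1]
  have b10 : s₂.reg 10 = j := by rw [hf₂ _ (by decide), h10]
  rw [hor, ← and_assoc, ← hi₂]
  refine (runs_forLoop (N := n) (T := 40) (fun i' s' =>
    s'.mem = s.mem ∧ s'.reg 13 ≤ 1 ∧ (s'.reg 13 = 1 ↔ s₂.reg 13 = 1 ∧ ∀ i₁ < i',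
      ¬ (code S i j = 0 ∧ code S i₁ j = 1))) (by decide) (by decide) (by decide) b0
    (by omega) (by simp [hm₂, hle₂]) ?_).mono le_rfl fun s' _ h => by simpa using h
  rintro i' hi' s₃ ⟨hm₃, hle₃, hi₃⟩ h11 hf₃
  have c1 : s₃.reg 1 = ℓ := by rw [hf₃ _ (by decide), b1]
  have c8 : s₃.reg 8 = i := by rw [hf₃ _ (by decide), h8]
  have c10 : s₃.reg 10 = j := by rw [hf₃ _ (by decide), b10]
  rw [hor, ← and_assoc, ← hi₃]
  have l1 := mul_add_lt hi hj
  have l2 := mul_add_lt hi' hj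
  have k1 := code_le S i j
  have k2 := code_le S i' j
  refine Runs.ite 5 ?_ (by simp [Expr.cost]) ?_ ?_
  · simp only [Expr.Fits, Expr.eval, c1, c8, c10, h11, hm₃, hS i hi j hj, hS i' hi' j hj]
    generalize code S i j = x at *
    generalize code S i' j = y at *
    have : y * (2 - y) ≤ 1 := by interval_cases y <;> simp
    have : (1 - x) * (y * (2 - y)) ≤ 1 * 1 := Nat.mul_le_mul (by omega) this
    omega
  · intro h
    simp only [Expr.eval, c1, c8, c10, h11, hm₃, hS i hi j hj, hS i' hi' j hj,
      Nat.mul_ne_zero_iff] at h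
    have : code S i j = 0 ∧ code S i' j = 1 := by omega
    exact Runs.assign (by simp [Expr.Fits]) (by simp [Expr.cost]) (by simp [Expr.eval, hm₃, this])
  · intro h
    simp only [Expr.eval, c1, c8, c10, h11, hm₃, hS i hi j hj, hS i' hi' j hj,
      Nat.mul_eq_zero] at h
    have : ¬ (code S i j = 0 ∧ code S i' j = 1) := by omega
    exact Runs.skip (by simp) (by simp only [hm₃]; simp [hle₃, this])

/-! ### The program -/

/-- The program that decides the problem. -/
def program : Prog :=
  .ite (.sub (.lit 2) (.reg 0)) (.assign 0 (.lit 1))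
    (.ite (.reg 2)
      (.ite (.sub (.reg 0) (.add (.reg 1) (.lit 1))) (.assign 0 (.lit 0))
        (.seq (.assign 4 (.lit 4)) (.seq (.assign 5 (.mul (.reg 0) (.reg 1)))
          (.seq (.assign 6 (.mul (.reg 4) (.reg 0))) (.seq searchProg
            (.assign 0 (.sub (.lit 1) (.sub (.lit 1) (.reg 13)))))))))
      (.seq compatProg (.assign 0 (.reg 13))))

theorem hasMatrix_input {n ℓ : ℕ} (S : PartialMatrix n ℓ) (α β : ℕ) :
    HasMatrix S (input S α β).mem := by
  intro i hi j hj
  have hlt := mul_add_lt hi hj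
  have e1 : Fin.divNat (n := ℓ) (⟨i * ℓ + j, hlt⟩ : Fin (n * ℓ)) = ⟨i, hi⟩ := by
    apply Fin.ext
    simp only [Fin.divNat]
    rw [mul_comm, Nat.mul_add_div (by omega), Nat.div_eq_of_lt hj]
    rfl
  have e2 : Fin.modNat (m := n) (⟨i * ℓ + j, hlt⟩ : Fin (n * ℓ)) = ⟨j, hj⟩ := by
    apply Fin.ext
    simp only [Fin.modNat]
    rw [mul_comm, Nat.mul_add_mod, Nat.mod_eq_of_lt hj]
  simp only [input, dif_pos hlt, e1, e2, code, dif_pos (And.intro hi hj)]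

/-- All needed numbers are bounded by a multiple of `W²`, and `W ≥ 2` turns six further factors `W`
into the constant 64. -/
theorem large_pow (n ℓ α β : ℕ) : Large ((n + ℓ + α + β + 2) ^ 8) n ℓ α := by
  unfold Large
  have h2 : 2 ≤ n + ℓ + α + β + 2 := by omega
  have hn : n + ℓ + α ≤ n + ℓ + α + β + 2 := by omega
  generalize n + ℓ + α + β + 2 = W at *
  have h64 : 64 * W ^ 2 ≤ W ^ 8 := by
    calc 64 * W ^ 2 = 2 ^ 6 * W ^ 2 := by norm_num
      _ ≤ W ^ 6 * W ^ 2 := Nat.mul_le_mul_right _ (Nat.pow_le_pow_left h2 6)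
      _ = W ^ 8 := by ring
  have a1 : n * ℓ ≤ W * W := Nat.mul_le_mul (by omega) (by omega)
  have a2 : n * n ≤ W * W := Nat.mul_le_mul (by omega) (by omega)
  have a3 : n * (ℓ + α) ≤ W * W := Nat.mul_le_mul (by omega) (by omega)
  have a4 : 2 * W ≤ W * W := Nat.mul_le_mul_right _ h2
  rw [mul_assoc 16 n n]
  nlinarith

end DMC

namespace DMC

open RAM

theorem runs_program {B n ℓ α : ℕ} {S : PartialMatrix n ℓ} (hS : maxMissing S ≤ 2)
    (hB : Large B n ℓ α) : Runs B program (input S α α) (100000 * (n ^ 2 * ℓ + 1)) fun s' =>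
      (IsYes S α α → s'.reg 0 = 1) ∧ (¬ IsYes S α α → s'.reg 0 = 0) := by
  have hM := hasMatrix_input S α α
  have r0 : (input S α α).reg 0 = n := rfl
  have r1 : (input S α α).reg 1 = ℓ := rfl
  have r2 : (input S α α).reg 2 = α := rfl
  have hB' := hB
  unfold Large at hB'
  generalize input S α α = s at *
  refine Runs.ite (100000 * (n ^ 2 * ℓ + 1) - 4) ?_ (by simp [Expr.cost]; omega) ?_ ?_
  · simp only [Expr.Fits]; omega
  · intro h
    simp only [Expr.eval] at h
    have hY := isYes_of_le_one (by omega : n < 2) S α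
    exact Runs.assign (by simp [Expr.Fits]; omega) (by simp [Expr.cost]; omega)
      (by simp [Expr.eval, hY])
  intro h
  simp only [Expr.eval] at h
  have hn : 2 ≤ n := by omega
  have hnn : 2 * n ≤ n ^ 2 := by nlinarith
  refine Runs.ite (100000 * (n ^ 2 * ℓ + 1) - 6) ?_ (by simp [Expr.cost]; omega) ?_ ?_
  · simp only [Expr.Fits]; omega
  · intro hα
    simp only [Expr.eval, r2] at hα
    refine Runs.ite (100000 * (n ^ 2 * ℓ + 1) - 12) ?_ (by simp [Expr.cost]; omega) ?_ ?_
    · simp only [Expr.Fits, Expr.eval]; omega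
    · intro h'
      simp only [Expr.eval] at h'
      have hN := not_isYes_of_lt hα (by omega : ℓ + 1 < n) S
      exact Runs.assign (by simp [Expr.Fits]) (by simp [Expr.cost]; omega)
        (by simp [Expr.eval, hN])
    · intro h'
      simp only [Expr.eval] at h'
      have htime : 4 * ((n ^ 2 * (16 * (ℓ * 78 + 60) + 260) + (n * (n ^ 2 * 6660 + 8) + 6) + 40)
          + 8) + 8 + 100 ≤ 100000 * (n ^ 2 * ℓ + 1) := by
        -- From `2 ≤ n ≤ ℓ + 1` follow `1 ≤ ℓ` and `n ≤ 2 * ℓ`; this absorbs the cubic cost of the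
        -- elimination.
        have t1 : n ^ 2 * n ≤ n ^ 2 * (2 * ℓ) := Nat.mul_le_mul_left _ (by omega)
        have t2 : n ^ 2 * 1 ≤ n ^ 2 * ℓ := Nat.mul_le_mul_left _ (by omega)
        nlinarith
      refine Runs.assign_seq (100000 * (n ^ 2 * ℓ + 1) - 14) (by simp [Expr.Fits]; omega)
        (by simp [Expr.cost]; omega) ?_
      refine Runs.assign_seq (100000 * (n ^ 2 * ℓ + 1) - 18) ?_ (by simp [Expr.cost]; omega) ?_
      · simp [Expr.Fits, Expr.eval, r0, r1]; omega
      refine Runs.assign_seq (100000 * (n ^ 2 * ℓ + 1) - 22) ?_ (by simp [Expr.cost]; omega) ?_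
      · simp [Expr.Fits, Expr.eval, r0]; omega
      refine Runs.seq _ 10 ?_ (Runs.mono (runs_searchProg hS hB (by omega)
        ⟨by simp [r0], by simp [r1], by simp [r2], by simp [Expr.eval],
          by simp [Expr.eval, r0, r1], by simp [Expr.eval, r0]⟩ hM) le_rfl ?_)
      · omega
      · rintro s₁ - ⟨hle, hiff⟩
        refine Runs.assign (by simp only [Expr.Fits]; omega) (by simp [Expr.cost]) ?_
        -- The term `1 - (1 - x)` turns the count of successful guesses into 0 or 1.
        simp only [Expr.eval, Function.update_self]
        constructor
        · intro hY
          have := hiff.2 hY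
          omega
        · intro hY
          have := mt hiff.1 hY
          omega
  · intro hα
    simp only [Expr.eval, r2] at hα
    subst hα
    refine Runs.seq _ 2 ?_ (Runs.mono (runs_compatProg hB r0 r1 hM) le_rfl ?_)
    · have t1 : 2 * n * ℓ ≤ n ^ 2 * ℓ := Nat.mul_le_mul_right _ hnn
      have t2 : 2 * ℓ ≤ n * ℓ := Nat.mul_le_mul_right _ hn
      have : ℓ * ((n * ((n * (40 + 8) + 6) + 8) + 6) + 8) + 8 + 2 + 6
          ≤ 100000 * (n ^ 2 * ℓ + 1) := by nlinarith
      omega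
    · rintro s₁ - ⟨hle, hiff⟩
      refine Runs.assign (by simp only [Expr.Fits]; omega) (by simp [Expr.cost]) ?_
      simp only [Expr.eval, Function.update_self]
      refine ⟨hiff.2, fun hY => ?_⟩
      have := mt hiff.1 hY
      omega

end DMC

theorem mainTheorem10 :
    ∃ (P : RAM.Prog) (C c : ℕ), ∀ (n ℓ α β : ℕ) (S : DMC.PartialMatrix n ℓ),
      DMC.maxMissing S ≤ 2 → α = β →
        ∃ (t : ℕ) (s : RAM.State),
          RAM.Exec ((n + ℓ + α + β + 2) ^ c) P (DMC.input S α β) t s ∧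
          t ≤ C * (n ^ 2 * ℓ + 1) ∧
          (DMC.IsYes S α β → s.reg 0 = 1) ∧
          (¬ DMC.IsYes S α β → s.reg 0 = 0) := by
  refine ⟨DMC.program, 100000, 8, ?_⟩
  rintro n ℓ α _ S hS rfl
  exact DMC.runs_program hS (DMC.large_pow n ℓ α α)
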